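/- Let $X$ be a complex Hilbert space, let $A$ be a bounded selfadjoint Fredholm operator on $X$, and let $P$ be an orthogonal projection on $X$ with $\dim\ker P<\infty$. Put $\mathcal I(x,y)=(Ax,y)$ for $x,y\in X$, $M=\operatorname{im}P$, and $N=\{x\in X:\ \mathcal I(x,y)=0\ \text{for all } y\in M\}$. Then $N$ and $\ker\mathcal I$ are finite-dimensional, the relative Morse index $I(PAP,A)$ is well defined, and $$I(PAP,A)=m^-(\mathcal I|_N)+\dim_{\mathbf C}\ker(\mathcal I|_N)-\dim_{\mathbf C}\ker\mathcal I .$$ Here, for a Hermitian form $\mathcal J$ on a complex vector space $V$, $\ker\mathcal J=\{x\in V:\mathcal J(x,y)=0\ \text{for all }y\in V\}$, and $m^-(\mathcal J)$ is the supremum of the dimensions of the finite-dimensional subspaces of $V$ on which $\mathcal J$ is negative definite. For bounded selfadjoint Fredholm operators $A_0,A_1$ with $A_1-A_0$ compact, the relative Morse index is $I(A_0,A_1)=-\mathrm{sf}\{A_0+s(A_1-A_0);\,0\le s\le 1\}$. The spectral flow $\mathrm{sf}\{A_s\}$ of a norm-continuous curve $A_s$, $0\le s\le1$, of bounded selfadjoint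 Fredholm operators is the number of eigenvalues, counted with multiplicity, that cross from $(-\infty,0)$ to $[0,\infty)$ minus the number that cross from $[0,\infty)$ to $(-\infty,0)$. Precisely, choose a subdivision $0=t_0\le t_1\le\dots\le t_n=1$ and $\varepsilon_1,\dots,\varepsilon_n>0$ such that for all $s\in[t_{j-1},t_j]$ the points $\pm\varepsilon_j$ are not in the spectrum of $A_s$ and the spectrum of $A_s$ in $[-\varepsilon_j,\varepsilon_j]$ consists of finitely many eigenvalues of finite multiplicity. Then $$\mathrm{sf}\{A_s\}=\sum_{j=1}^n\bigl(d_j(t_j)-d_j(t_{j-1})\bigr),$$ where $d_j(s)$ is the number of eigenvalues of $A_s$ in $[0,\varepsilon_j]$, counted with multiplicity. That $I(A_0,A_1)$ is well defined means that such choices exist for the curve $A_0+s(A_1-A_0)$ and that all of them give the same value. -/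

import Mathlib

namespace RelMorse

section Forms

variable {V : Type*} [AddCommGroup V] [Module ℂ V]

/-- The orthogonal complement `{x | I(x, y) = 0 for all y ∈ M}` of a subspace `M` with respect to
a sesquilinear form `I`. -/
def formCompl (I : V →ₗ⋆[ℂ] V →ₗ[ℂ] ℂ) (M : Submodule ℂ V) : Submodule ℂ V where
  carrier := {x | ∀ y ∈ M, I x y = 0}
  zero_mem' := by simp
  add_mem' {u v} hu hv y hy := by simp [hu y hy, hv y hy]
  smul_mem' c x hx y hy := by simp [hx y hy]

/-- The restriction `I|_N` of a sesquilinear form to a subspace `N`. -/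
def formRestrict (I : V →ₗ⋆[ℂ] V →ₗ[ℂ] ℂ) (N : Submodule ℂ V) : N →ₗ⋆[ℂ] N →ₗ[ℂ] ℂ :=
  I.domRestrict₁₂ N N

/-- The kernel `{x | I(x, y) = 0 for all y}` of a sesquilinear form. -/
def formKer (I : V →ₗ⋆[ℂ] V →ₗ[ℂ] ℂ) : Submodule ℂ V := formCompl I ⊤

/-- The form is negative definite on the subspace `W`. -/
def NegDefOn (I : V →ₗ⋆[ℂ] V →ₗ[ℂ] ℂ) (W : Submodule ℂ V) : Prop :=
  ∀ x ∈ W, x ≠ 0 → (I x x).re < 0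

/-- The Morse (negative) index `m⁻(I)` of a Hermitian form: the supremum (possibly `⊤`) of the
dimensions of the finite-dimensional subspaces on which `I` is negative definite. -/
noncomputable def morseIndex (I : V →ₗ⋆[ℂ] V →ₗ[ℂ] ℂ) : ℕ∞ :=
  ⨆ (W : Submodule ℂ V) (_ : FiniteDimensional ℂ W ∧ NegDefOn I W),
    (Module.finrank ℂ W : ℕ∞)

end Forms

variable {X : Type*} [NormedAddCommGroup X] [InnerProductSpace ℂ X] [CompleteSpace X]

/-- The quadratic form `I(x, y) = (A x, y)` of a bounded operator `A`. -/
noncomputable def opForm (A : X →L[ℂ] X) : X →ₗ⋆[ℂ] X →ₗ[ℂ] ℂ :=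
  (innerₛₗ ℂ).comp (A : X →ₗ[ℂ] X)

/-- `e > 0` is an admissible level for the selfadjoint operator `A`: `e` and `-e` are not in the
spectrum of `A`, and the spectrum of `A` in `[-e, e]` consists of finitely many eigenvalues of
finite multiplicity. -/
def IsAdmissibleLevel (A : X →L[ℂ] X) (e : ℝ) : Prop :=
  0 < e ∧ (e : ℂ) ∉ spectrum ℂ A ∧ ((-e : ℝ) : ℂ) ∉ spectrum ℂ A ∧
    {r : ℝ | r ∈ Set.Icc (-e) e ∧ (r : ℂ) ∈ spectrum ℂ A}.Finite ∧
    ∀ r ∈ Set.Icc (-e) e,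
      FiniteDimensional ℂ (Module.End.eigenspace (A : X →ₗ[ℂ] X) (r : ℂ))

/-- The number of eigenvalues of the selfadjoint operator `A` in `[0, e]`, counted with
multiplicity, i.e. the dimension of the sum of the corresponding eigenspaces. -/
noncomputable def nonnegCount (A : X →L[ℂ] X) (e : ℝ) : ℕ :=
  Module.finrank ℂ
    (⨆ r ∈ Set.Icc (0 : ℝ) e, Module.End.eigenspace (A : X →ₗ[ℂ] X) (r : ℂ) : Submodule ℂ X)

/-- A subdivision `0 = t 0 ≤ t 1 ≤ ⋯ ≤ t n = 1` together with levels `e j` such that `e j` is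
admissible for `A s` for all `s ∈ [t j, t (j + 1)]`. -/
structure IsFlowSubdivision (A : ℝ → X →L[ℂ] X) (n : ℕ) (t e : ℕ → ℝ) : Prop where
  start : t 0 = 0
  finish : t n = 1
  le_succ : ∀ j < n, t j ≤ t (j + 1)
  admissible : ∀ j < n, ∀ s ∈ Set.Icc (t j) (t (j + 1)), IsAdmissibleLevel (A s) (e j)

/-- The net number of eigenvalues that pass from the negative to the nonnegative half-line,
computed from a subdivision. -/
noncomputable def flowSum (A : ℝ → X →L[ℂ] X) (n : ℕ) (t e : ℕ → ℝ) : ℤ :=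
  ∑ j ∈ Finset.range n,
    ((nonnegCount (A (t (j + 1))) (e j) : ℤ) - (nonnegCount (A (t j)) (e j) : ℤ))

/-- `A s`, `0 ≤ s ≤ 1`, is a norm-continuous curve of bounded selfadjoint Fredholm operators whose
spectral flow is well defined and equal to `k`: subdivisions with admissible levels exist, and each
of them gives the net number `k` of eigenvalues crossing from negative to nonnegative. -/
structure HasSpectralFlow (A : ℝ → X →L[ℂ] X) (k : ℤ) : Prop where
  continuousOn : ContinuousOn A (Set.Icc 0 1)
  selfAdjoint : ∀ s ∈ Set.Icc (0 : ℝ) 1, IsSelfAdjoint (A s)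
  fredholm : ∀ s ∈ Set.Icc (0 : ℝ) 1, (A s).IsFredholm
  exists_subdivision : ∃ n t e, IsFlowSubdivision A n t e
  flowSum_eq : ∀ n t e, IsFlowSubdivision A n t e → flowSum A n t e = k

/-- The relative Morse index `I(A₀, A₁)` of two bounded selfadjoint Fredholm operators with compact
difference is well defined and equal to `k`, where `I(A₀, A₁) = - sf {A₀ + s (A₁ - A₀)}`. -/
def HasRelativeMorseIndex (A₀ A₁ : X →L[ℂ] X) (k : ℤ) : Prop :=
  IsCompactOperator (A₁ - A₀) ∧
    HasSpectralFlow (fun s : ℝ => A₀ + (s : ℂ) • (A₁ - A₀)) (-k)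

/-- The value of the relative Morse index is unique. -/
theorem HasRelativeMorseIndex.unique {A₀ A₁ : X →L[ℂ] X} {k l : ℤ}
    (hk : HasRelativeMorseIndex A₀ A₁ k) (hl : HasRelativeMorseIndex A₀ A₁ l) : k = l := by
  obtain ⟨n, t, e, h⟩ := hk.2.exists_subdivision
  have h1 := hk.2.flowSum_eq n t e h
  have h2 := hl.2.flowSum_eq n t e h
  linarith

end RelMorse

/-! Write A₀ = PAP and B_s = A₀ + s(A − A₀). Since ker P is finite-dimensional, A − A₀ has finite
rank; moreover P(A − A₀)P = 0, so P B_s P = A₀ for all s, and the form of B_s on M never changes.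
With N_s the B_s-orthogonal complement of M, put r(s) = m⁻(B_s|N_s) + dim ker(B_s|N_s) − dim ker B_s
(`relIdx`). The core of the proof is that, where a level e is admissible for all B_s, the sum of
r(s) and the number of eigenvalues of B_s in [0, e] is constant in s
(`nonnegCount_sub_nonnegCount`). The flow therefore telescopes to r(0) − r(1), and r(0) = 0 because
N_0 = ker A₀.

To prove this constancy, eigenvalues are counted in finite dimensions. There is a projection Q of
finite corank, with range inside M, such that the compression of A₀ − z to ran Q is invertible for
all z in [0, e]. It is also the compression of B_s − z, so a single inverse R(z) serves for every s
(`exists_isCompressionInverse`). The Schur complement of B_s − z on F = ker Q has the nullity of B_s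
− z, and on F its form is strictly decreasing in z. Its negative index thus grows from z = 0 to z =
e by the number of eigenvalues in [0, e] (`negIdx_schur_eq_add_nonnegCount`). At z = e it is
nondegenerate on F, so there its index does not depend on s.

At z = 0 its index is that of B_s on Y = {x : Q B_s x = 0}. A finite-dimensional identity
(`negIdx_add_finrank_rad`), applied to M ∩ Y inside Y, splits this index into a contribution of M ∩
Y, which depends on A₀ only, plus r(s) (`negIdx_schur_eq_add_relIdx`). -/

namespace RelMorse

open Submodule ComplexConjugate Filter Topology

/-! ### Hermitian forms: inertia and orthogonal complements in finite dimensions. -/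

section HermitianForms

variable {V : Type*} [AddCommGroup V] [Module ℂ V]

/-- The sesquilinear form `J` is Hermitian. -/
def IsHermForm (J : V →ₗ⋆[ℂ] V →ₗ[ℂ] ℂ) : Prop := ∀ x y, J y x = conj (J x y)

/-- The form is nonnegative on the subspace `W`. -/
def NonnegOn (J : V →ₗ⋆[ℂ] V →ₗ[ℂ] ℂ) (W : Submodule ℂ V) : Prop :=
  ∀ x ∈ W, 0 ≤ (J x x).re

/-- The radical of the restriction of a form to a subspace. -/
def rad (J : V →ₗ⋆[ℂ] V →ₗ[ℂ] ℂ) (H : Submodule ℂ V) : Submodule ℂ V := H ⊓ formCompl J H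

/-- The negative index of the restriction of a form to a finite-dimensional subspace. -/
noncomputable def negIdx (J : V →ₗ⋆[ℂ] V →ₗ[ℂ] ℂ) (H : Submodule ℂ V) : ℕ :=
  sSup {n | ∃ W ≤ H, NegDefOn J W ∧ Module.finrank ℂ W = n}

variable {J : V →ₗ⋆[ℂ] V →ₗ[ℂ] ℂ}

theorem mem_formCompl {M : Submodule ℂ V} {x : V} :
    x ∈ formCompl J M ↔ ∀ y ∈ M, J x y = 0 := Iff.rfl

theorem IsHermForm.eq_zero_symm (hJ : IsHermForm J) {x y : V} (h : J x y = 0) : J y x = 0 := by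
  rw [hJ x y, h, map_zero]

theorem IsHermForm.neg (hJ : IsHermForm J) : IsHermForm (-J) := fun x y => by
  simp [hJ x y]

theorem IsHermForm.re_symm (hJ : IsHermForm J) (x y : V) : (J y x).re = (J x y).re := by
  rw [hJ x y, Complex.conj_re]

theorem IsHermForm.re_add (hJ : IsHermForm J) (x y : V) :
    (J (x + y) (x + y)).re = (J x x).re + 2 * (J x y).re + (J y y).re := by
  have := hJ.re_symm x y
  simp only [map_add, LinearMap.add_apply, Complex.add_re]
  linarith

theorem re_smul_smul (c : ℂ) (x : V) : (J (c • x) (c • x)).re = ‖c‖ ^ 2 * (J x x).re := by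
  simp only [map_smulₛₗ, LinearMap.smul_apply, smul_eq_mul, RingHom.id_apply]
  rw [show ∀ z : ℂ, c * (conj c * z) = (c * conj c) * z from fun z => by ring, Complex.mul_conj,
    Complex.normSq_eq_norm_sq, Complex.re_ofReal_mul]

theorem formCompl_neg (M : Submodule ℂ V) : formCompl (-J) M = formCompl J M := by
  ext x
  simp [mem_formCompl]

theorem NegDefOn.mono {W W' : Submodule ℂ V} (h : NegDefOn J W) (hW : W' ≤ W) : NegDefOn J W' :=
  fun x hx => h x (hW hx)

theorem NegDefOn.disjoint {W C : Submodule ℂ V} (h : NegDefOn J W) (hC : NonnegOn J C) :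
    Disjoint W C := by
  rw [Submodule.disjoint_def]
  intro x hx hx'
  by_contra h0
  exact absurd (h x hx h0) (not_lt.2 (hC x hx'))

theorem NegDefOn.sup_of_orthogonal (hJ : IsHermForm J) {W W' : Submodule ℂ V} (h : NegDefOn J W)
    (h' : NegDefOn J W') (ho : W' ≤ formCompl J W) : NegDefOn J (W ⊔ W') := by
  intro x hx hx0
  obtain ⟨a, ha, b, hb, rfl⟩ := Submodule.mem_sup.1 hx
  have h0 : J a b = 0 := hJ.eq_zero_symm (ho hb a ha)
  rw [hJ.re_add, h0]
  by_cases ha0 : a = 0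
  · have hb0 : b ≠ 0 := by rintro rfl; simp [ha0] at hx0
    simpa [ha0] using h' b hb hb0
  · have h1 := h a ha ha0
    by_cases hb0 : b = 0
    · simpa [hb0] using h1
    · have h2 := h' b hb hb0
      simp only [Complex.zero_re]
      linarith

theorem NonnegOn.sup_of_orthogonal (hJ : IsHermForm J) {W W' : Submodule ℂ V} (h : NonnegOn J W)
    (h' : NonnegOn J W') (ho : W' ≤ formCompl J W) : NonnegOn J (W ⊔ W') := by
  intro x hx
  obtain ⟨a, ha, b, hb, rfl⟩ := Submodule.mem_sup.1 hx
  have h0 : J a b = 0 := hJ.eq_zero_symm (ho hb a ha)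
  rw [hJ.re_add, h0]
  have h1 := h a ha
  have h2 := h' b hb
  simp only [Complex.zero_re]
  linarith

/-- The degenerate case of Cauchy–Schwarz: with z = J x y, the value of the form at t z x + y is
affine in t with slope 2‖z‖², hence not bounded below unless z = 0. -/
theorem IsHermForm.eq_zero_of_nonnegOn (hJ : IsHermForm J) {C : Submodule ℂ V} (hC : NonnegOn J C)
    {x y : V} (hx : x ∈ C) (hy : y ∈ C) (h : (J x x).re = 0) : J x y = 0 := by
  by_contra h0
  set z := J x y with hz
  have hz0 : 0 < ‖z‖ ^ 2 := by positivity
  have key : ∀ t : ℝ, 0 ≤ 2 * t * ‖z‖ ^ 2 + (J y y).re := by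
    intro t
    have h1 := hC (((t : ℂ) * z) • x + y)
      (C.add_mem (C.smul_mem _ hx) hy)
    rw [hJ.re_add, re_smul_smul, h] at h1
    have h2 : (J (((t : ℂ) * z) • x) y).re = t * ‖z‖ ^ 2 := by
      simp only [map_smulₛₗ, LinearMap.smul_apply, smul_eq_mul, ← hz, map_mul, Complex.conj_ofReal]
      rw [mul_assoc, mul_comm (conj z), Complex.mul_conj, Complex.normSq_eq_norm_sq,
        Complex.re_ofReal_mul, Complex.ofReal_re]
    rw [h2] at h1
    linarith
  -- This t makes the affine function equal to −(J y y).re − 2, which is negative.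
  have := key (-((J y y).re + 1) / ‖z‖ ^ 2)
  field_simp at this
  have hy0 := hC y hy
  linarith

section Finite

theorem finrank_sup_of_disjoint {W C : Submodule ℂ V} [FiniteDimensional ℂ W]
    [FiniteDimensional ℂ C] (h : Disjoint W C) :
    Module.finrank ℂ ↥(W ⊔ C) = Module.finrank ℂ W + Module.finrank ℂ C := by
  rw [← Submodule.finrank_sup_add_finrank_inf_eq, h.eq_bot, finrank_bot, add_zero]

theorem finrank_add_le_of_disjoint {W C H : Submodule ℂ V} [FiniteDimensional ℂ H]
    (hW : W ≤ H) (hC : C ≤ H) (h : Disjoint W C) :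
    Module.finrank ℂ W + Module.finrank ℂ C ≤ Module.finrank ℂ H := by
  have := Submodule.finiteDimensional_of_le hW
  have := Submodule.finiteDimensional_of_le hC
  rw [← finrank_sup_of_disjoint h]
  exact Submodule.finrank_mono (sup_le hW hC)

theorem bddAbove_negIdx (H : Submodule ℂ V) [FiniteDimensional ℂ H] :
    BddAbove {n | ∃ W ≤ H, NegDefOn J W ∧ Module.finrank ℂ W = n} := by
  refine ⟨Module.finrank ℂ H, ?_⟩
  rintro n ⟨W, hW, -, rfl⟩
  exact Submodule.finrank_mono hW

theorem NegDefOn.finrank_le_negIdx {W H : Submodule ℂ V} [FiniteDimensional ℂ H] (hW : W ≤ H)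
    (h : NegDefOn J W) : Module.finrank ℂ W ≤ negIdx J H :=
  le_csSup (bddAbove_negIdx H) ⟨W, hW, h, rfl⟩

theorem exists_finrank_eq_negIdx (J : V →ₗ⋆[ℂ] V →ₗ[ℂ] ℂ) (H : Submodule ℂ V)
    [FiniteDimensional ℂ H] :
    ∃ W ≤ H, NegDefOn J W ∧ Module.finrank ℂ W = negIdx J H := by
  have : negIdx J H ∈ {n | ∃ W ≤ H, NegDefOn J W ∧ Module.finrank ℂ W = n} :=
    Nat.sSup_mem ⟨0, ⊥, bot_le, fun x hx h0 => absurd ((Submodule.mem_bot ℂ).1 hx) h0,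
      finrank_bot ℂ V⟩ (bddAbove_negIdx H)
  exact this

/-- The complement of W in H is cut out by the functionals `J w`. Those with w in W ∩ H^⊥ vanish on
H, so only a linear complement W' of that subspace in W imposes conditions. Exchanging H and W turns
the inequality into an equality. -/
theorem finrank_le_finrank_inf_formCompl (hJ : IsHermForm J) (H W : Submodule ℂ V)
    [FiniteDimensional ℂ H] [FiniteDimensional ℂ W] :
    Module.finrank ℂ H + Module.finrank ℂ ↥(W ⊓ formCompl J H) ≤
      Module.finrank ℂ ↥(H ⊓ formCompl J W) + Module.finrank ℂ W := by
  obtain ⟨W', hW'⟩ := Submodule.exists_isCompl ((W ⊓ formCompl J H).comap W.subtype)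
  set b := Module.finBasis ℂ W' with hb
  set f : H →ₗ[ℂ] (Fin (Module.finrank ℂ W') → ℂ) :=
    LinearMap.pi (fun i => (J (b i : W)) ∘ₗ H.subtype) with hf
  have h1 := f.finrank_range_add_finrank_ker
  have h2 : Module.finrank ℂ (LinearMap.range f) ≤ Module.finrank ℂ W' := by
    refine (Submodule.finrank_le _).trans ?_
    simp
  have h3 : Module.finrank ℂ ↥(W ⊓ formCompl J H) + Module.finrank ℂ W' = Module.finrank ℂ W := by
    have := Submodule.finrank_add_eq_of_isCompl hW'
    rw [← this, (Submodule.comapSubtypeEquivOfLe inf_le_left).finrank_eq]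
  have h4 : Module.finrank ℂ (LinearMap.ker f) ≤ Module.finrank ℂ ↥(H ⊓ formCompl J W) := by
    rw [← Submodule.finrank_map_subtype_eq]
    refine Submodule.finrank_mono ?_
    rintro _ ⟨x, hx, rfl⟩
    refine ⟨x.2, fun y hy => ?_⟩
    have hx' : ∀ w : W, w ∈ W' → J w x = 0 := by
      intro w hw
      have h5 : W' ≤ (LinearMap.ker ((J.flip (x : V)) ∘ₛₗ W.subtype)) := by
        rw [← W'.map_subtype_top, ← b.span_eq, Submodule.map_span, Submodule.span_le]
        rintro _ ⟨_, ⟨i, rfl⟩, rfl⟩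
        have := congrFun (LinearMap.mem_ker.1 hx) i
        simpa [hf] using this
      simpa using h5 hw
    have hy' : (⟨y, hy⟩ : W) ∈ (W ⊓ formCompl J H).comap W.subtype ⊔ W' := by
      rw [hW'.sup_eq_top]; trivial
    obtain ⟨u, hu, v, hv, huv⟩ := Submodule.mem_sup.1 hy'
    have : y = u + v := by rw [← Submodule.coe_add, huv]
    apply hJ.eq_zero_symm
    rw [this, map_add, LinearMap.add_apply]
    erw [hx' v hv]
    rw [add_zero]
    exact (Submodule.mem_comap.1 hu).2 x x.2
  omega

theorem finrank_inf_formCompl_add (hJ : IsHermForm J) (H W : Submodule ℂ V)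
    [FiniteDimensional ℂ H] [FiniteDimensional ℂ W] :
    Module.finrank ℂ ↥(H ⊓ formCompl J W) + Module.finrank ℂ W =
      Module.finrank ℂ H + Module.finrank ℂ ↥(W ⊓ formCompl J H) := by
  have h1 := finrank_le_finrank_inf_formCompl hJ H W
  have h2 := finrank_le_finrank_inf_formCompl hJ W H
  omega

/-- A maximal negative subspace and its orthogonal complement. -/
theorem exists_negDefOn_nonnegOn (hJ : IsHermForm J) (H : Submodule ℂ V) [FiniteDimensional ℂ H] :
    ∃ W ≤ H, ∃ C ≤ H, NegDefOn J W ∧ NonnegOn J C ∧ Module.finrank ℂ W = negIdx J H ∧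
      W ⊔ C = H ∧ Disjoint W C ∧ C ≤ formCompl J W := by
  obtain ⟨W, hWH, hW, hWn⟩ := exists_finrank_eq_negIdx J H
  have := Submodule.finiteDimensional_of_le hWH
  -- A vector of negative value in the complement could be adjoined to W, against its maximal
  -- dimension.
  have hC : NonnegOn J (H ⊓ formCompl J W) := by
    intro c hc
    by_contra! hlt
    have hc0 : c ≠ 0 := by rintro rfl; simp at hlt
    have hs : NegDefOn J (ℂ ∙ c) := by
      intro x hx hx0
      obtain ⟨a, rfl⟩ := Submodule.mem_span_singleton.1 hx
      have ha : a ≠ 0 := by rintro rfl; simp at hx0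
      rw [re_smul_smul]
      exact mul_neg_of_pos_of_neg (by positivity) hlt
    have hsW : ℂ ∙ c ≤ formCompl J W := by
      rw [Submodule.span_singleton_le_iff_mem]; exact hc.2
    have hdis : Disjoint W (ℂ ∙ c) := by
      rw [Submodule.disjoint_def]
      intro x hx hx'
      by_contra hx0
      have := hW x hx hx0
      rw [hsW hx' x hx] at this
      simp at this
    have h1 := (hW.sup_of_orthogonal hJ hs hsW).finrank_le_negIdx
      (sup_le hWH ((Submodule.span_singleton_le_iff_mem _ _).2 hc.1))
    rw [finrank_sup_of_disjoint hdis, finrank_span_singleton hc0] at h1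
    omega
  have hdis := hW.disjoint hC
  refine ⟨W, hWH, H ⊓ formCompl J W, inf_le_left, hW, hC, hWn, ?_, hdis, inf_le_right⟩
  refine Submodule.eq_of_le_of_finrank_le (sup_le hWH inf_le_left) ?_
  rw [finrank_sup_of_disjoint hdis]
  have := finrank_le_finrank_inf_formCompl hJ H W
  omega

theorem NonnegOn.negIdx_add_le {C H : Submodule ℂ V} [FiniteDimensional ℂ H] (hC : NonnegOn J C)
    (hCH : C ≤ H) : negIdx J H + Module.finrank ℂ C ≤ Module.finrank ℂ H := by
  obtain ⟨W, hWH, hW, hWn⟩ := exists_finrank_eq_negIdx J H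
  rw [← hWn]
  exact finrank_add_le_of_disjoint hWH hCH (hW.disjoint hC)

theorem rad_le {H : Submodule ℂ V} : rad J H ≤ H := inf_le_left

/-- Sylvester's law of inertia. -/
theorem negIdx_add_negIdx_neg_add_rad (hJ : IsHermForm J) (H : Submodule ℂ V)
    [FiniteDimensional ℂ H] :
    negIdx J H + negIdx (-J) H + Module.finrank ℂ (rad J H) = Module.finrank ℂ H := by
  obtain ⟨W, hWH, C, hCH, hW, hC, hWn, hsup, hdis, hCo⟩ := exists_negDefOn_nonnegOn hJ H
  have := Submodule.finiteDimensional_of_le hWH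
  have := Submodule.finiteDimensional_of_le hCH
  have := Submodule.finiteDimensional_of_le (rad_le (J := J) (H := H))
  have hadd := finrank_sup_of_disjoint hdis
  rw [hsup] at hadd
  have hradW : Disjoint W (rad J H) := hW.disjoint fun x hx => by rw [hx.2 x hx.1]; simp
  apply le_antisymm
  -- The form is nonpositive on W ⊕ rad, which bounds the positive index from above.
  · have h1 : NonnegOn (-J) (W ⊔ rad J H) := by
      refine NonnegOn.sup_of_orthogonal hJ.neg (fun x hx => ?_) (fun x hx => ?_) ?_
      · by_cases h0 : x = 0
        · simp [h0]
        · have := hW x hx h0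
          simp only [LinearMap.neg_apply, Complex.neg_re]
          linarith
      · simp [hx.2 x hx.1]
      · rw [formCompl_neg]
        exact fun x hx y hy => hx.2 y (hWH hy)
    have h2 := h1.negIdx_add_le (sup_le hWH rad_le)
    rw [finrank_sup_of_disjoint hradW] at h2
    omega
  -- An isotropic vector of C is orthogonal to C by Cauchy–Schwarz and to W by construction, so it
  -- lies in the radical; hence the form is positive definite on C'.
  · obtain ⟨C', hC'⟩ := Submodule.exists_isCompl ((rad J H ⊓ C).comap C.subtype)
    have hneg : NegDefOn (-J) (C'.map C.subtype) := by
      rintro _ ⟨x, hx, rfl⟩ hx0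
      simp only [LinearMap.neg_apply, Complex.neg_re, Left.neg_neg_iff]
      refine lt_of_le_of_ne (hC _ x.2) fun h0 => hx0 ?_
      have hr : (x : V) ∈ rad J H := by
        refine ⟨hCH x.2, fun y hy => ?_⟩
        rw [← hsup] at hy
        obtain ⟨w, hw, c, hc, rfl⟩ := Submodule.mem_sup.1 hy
        rw [map_add, hCo x.2 w hw, zero_add]
        exact hJ.eq_zero_of_nonnegOn hC x.2 hc h0.symm
      have : x ∈ (rad J H ⊓ C).comap C.subtype ⊓ C' := ⟨⟨hr, x.2⟩, hx⟩
      rw [hC'.inf_eq_bot, Submodule.mem_bot] at this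
      simp [this]
    have h1 := hneg.finrank_le_negIdx (H := H) (by
      rintro _ ⟨x, -, rfl⟩; exact hCH x.2)
    rw [Submodule.finrank_map_subtype_eq] at h1
    have h2 := Submodule.finrank_add_eq_of_isCompl hC'
    rw [(Submodule.comapSubtypeEquivOfLe inf_le_right).finrank_eq] at h2
    have h3 : Module.finrank ℂ ↥(rad J H ⊓ C) ≤ Module.finrank ℂ (rad J H) :=
      Submodule.finrank_mono inf_le_left
    omega

/-- The nonnegative parts of M and N together span a nonnegative subspace, whose codimension in M +
N is at most the sum of the two indices. -/
theorem negIdx_sup_le (hJ : IsHermForm J) {M N : Submodule ℂ V} [FiniteDimensional ℂ M]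
    [FiniteDimensional ℂ N] (ho : N ≤ formCompl J M) :
    negIdx J (M ⊔ N) ≤ negIdx J M + negIdx J N := by
  obtain ⟨W, hWH, C, hCH, hW, hC, hWn, hsup, hdis, hCo⟩ := exists_negDefOn_nonnegOn hJ M
  obtain ⟨W', hWH', C', hCH', hW', hC', hWn', hsup', hdis', hCo'⟩ := exists_negDefOn_nonnegOn hJ N
  have h1 : NonnegOn J (C ⊔ C') :=
    hC.sup_of_orthogonal hJ hC' fun x hx y hy => ho (hCH' hx) y (hCH hy)
  have h2 := h1.negIdx_add_le (sup_le_sup hCH hCH')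
  have := Submodule.finiteDimensional_of_le hWH
  have := Submodule.finiteDimensional_of_le hCH
  have := Submodule.finiteDimensional_of_le hWH'
  have := Submodule.finiteDimensional_of_le hCH'
  have h3 : M ⊔ N = (C ⊔ C') ⊔ (W ⊔ W') := by
    rw [← hsup, ← hsup']; ac_rfl
  have h4 := Submodule.finrank_add_le_finrank_add_finrank (C ⊔ C') (W ⊔ W')
  have h5 := Submodule.finrank_add_le_finrank_add_finrank W W'
  rw [← h3] at h4
  omega

theorem negIdx_le_add_codim {H' H : Submodule ℂ V} [FiniteDimensional ℂ H] (h : H' ≤ H) :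
    negIdx J H + Module.finrank ℂ H' ≤ negIdx J H' + Module.finrank ℂ H := by
  obtain ⟨W, hWH, hW, hWn⟩ := exists_finrank_eq_negIdx J H
  have := Submodule.finiteDimensional_of_le hWH
  have := Submodule.finiteDimensional_of_le h
  have h1 := (hW.mono inf_le_left : NegDefOn J (W ⊓ H')).finrank_le_negIdx inf_le_right
  have h2 := Submodule.finrank_sup_add_finrank_inf_eq W H'
  have h3 := Submodule.finrank_mono (sup_le hWH h)
  omega

/-- The negative index of a Hermitian form in terms of a subspace and its orthogonal complement. -/
theorem negIdx_add_finrank_rad (hJ : IsHermForm J) {M Y : Submodule ℂ V} [FiniteDimensional ℂ Y]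
    (hM : M ≤ Y) :
    negIdx J Y + Module.finrank ℂ (rad J Y) = negIdx J M + negIdx J (Y ⊓ formCompl J M) +
      Module.finrank ℂ (rad J (Y ⊓ formCompl J M)) := by
  set N := Y ⊓ formCompl J M with hN
  have := Submodule.finiteDimensional_of_le hM
  have : FiniteDimensional ℂ N := Submodule.finiteDimensional_of_le inf_le_left
  have : FiniteDimensional ℂ (rad J Y) := Submodule.finiteDimensional_of_le rad_le
  have hMN : Module.finrank ℂ N + Module.finrank ℂ M =
      Module.finrank ℂ Y + Module.finrank ℂ ↥(M ⊓ formCompl J Y) := finrank_inf_formCompl_add hJ Y M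
  have hradYN : rad J Y ≤ N := fun x hx => ⟨hx.1, fun y hy => hx.2 y (hM hy)⟩
  have hNY : N ⊓ formCompl J Y = rad J Y :=
    le_antisymm (inf_le_inf_right _ inf_le_left) (le_inf hradYN inf_le_right)
  have hNN : Module.finrank ℂ ↥(Y ⊓ formCompl J N) + Module.finrank ℂ N =
      Module.finrank ℂ Y + Module.finrank ℂ ↥(rad J Y) := by
    rw [finrank_inf_formCompl_add hJ Y N, hNY]
  have hMr : M ⊓ rad J Y = M ⊓ formCompl J Y := by
    rw [rad, ← inf_assoc, inf_eq_left.2 hM]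
  have hMsup := Submodule.finrank_sup_add_finrank_inf_eq M (rad J Y)
  rw [hMr] at hMsup
  have hle : M ⊔ rad J Y ≤ Y ⊓ formCompl J N := by
    refine sup_le (fun x hx => ⟨hM hx, fun y hy => hJ.eq_zero_symm (hy.2 x hx)⟩)
      (fun x hx => ⟨hx.1, fun y hy => hx.2 y hy.1⟩)
  -- The double complement of M in Y is M + rad Y, by counting dimensions. This gives rad N = (N ∩
  -- M) + rad Y below.
  have heq : M ⊔ rad J Y = Y ⊓ formCompl J N := by
    have : FiniteDimensional ℂ ↥(Y ⊓ formCompl J N) :=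
      Submodule.finiteDimensional_of_le inf_le_left
    exact Submodule.eq_of_le_of_finrank_le hle (by omega)
  have hradN : rad J N = (N ⊓ M) ⊔ rad J Y := by
    rw [inf_sup_assoc_of_le _ hradYN, heq, rad, ← inf_assoc, inf_eq_left.2 (inf_le_left : N ≤ Y)]
  have hradN' := Submodule.finrank_sup_add_finrank_inf_eq (N ⊓ M) (rad J Y)
  have hNMr : (N ⊓ M) ⊓ rad J Y = M ⊓ formCompl J Y := by
    rw [← hMr, inf_assoc]
    exact inf_eq_right.2 (inf_le_right.trans hradYN)
  rw [← hradN, hNMr] at hradN'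
  have hradM : rad J M = N ⊓ M := by
    ext x
    exact ⟨fun h => ⟨⟨hM h.1, h.2⟩, h.1⟩, fun h => ⟨h.2, h.1.2⟩⟩
  have hsup := Submodule.finrank_sup_add_finrank_inf_eq M N
  rw [inf_comm M N] at hsup
  have sM := negIdx_add_negIdx_neg_add_rad hJ M
  have sN := negIdx_add_negIdx_neg_add_rad hJ N
  have sY := negIdx_add_negIdx_neg_add_rad hJ Y
  rw [hradM] at sM
  have hMNY : M ⊔ N ≤ Y := sup_le hM inf_le_left
  -- Each of the negative and positive indices of Y is at most the sum of those of M and N plus the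
  -- codimension of M + N in Y. By inertia these two upper bounds add up to dim Y − dim rad Y, so
  -- both are equalities.
  have a1 := negIdx_sup_le hJ (M := M) (N := N) inf_le_right
  have a2 := negIdx_sup_le hJ.neg (M := M) (N := N) (by rw [formCompl_neg]; exact inf_le_right)
  have b1 := negIdx_le_add_codim (J := J) hMNY
  have b2 := negIdx_le_add_codim (J := -J) hMNY
  omega

end Finite

end HermitianForms

/-! ### Selfadjoint Fredholm operators: finite rank perturbations and isolated spectrum. -/

section Operators

variable {X : Type*} [NormedAddCommGroup X] [InnerProductSpace ℂ X]

/-- A bounded operator of finite rank. -/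
def IsFinRank (K : X →L[ℂ] X) : Prop := (K : X →ₗ[ℂ] X).HasFiniteRange

theorem isFinRank_iff {K : X →L[ℂ] X} :
    IsFinRank K ↔ FiniteDimensional ℂ (LinearMap.range (K : X →ₗ[ℂ] X)) :=
  LinearMap.hasFiniteRange_iff_range.trans (Submodule.fg_iff_finiteDimensional _)

theorem IsFinRank.of_forall_mem {K : X →L[ℂ] X} {F : Submodule ℂ X} [FiniteDimensional ℂ F]
    (h : ∀ x, K x ∈ F) : IsFinRank K :=
  isFinRank_iff.2 (Submodule.finiteDimensional_of_le
    (LinearMap.range_le_iff_comap.2 (eq_top_iff.2 fun x _ => h x) :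
      LinearMap.range (K : X →ₗ[ℂ] X) ≤ F))

theorem IsFinRank.neg {K : X →L[ℂ] X} (h : IsFinRank K) : IsFinRank (-K) :=
  LinearMap.HasFiniteRange.neg h

theorem IsFinRank.add {K L : X →L[ℂ] X} (h : IsFinRank K) (h' : IsFinRank L) : IsFinRank (K + L) :=
  LinearMap.HasFiniteRange.add h h'

theorem IsFinRank.smul {K : X →L[ℂ] X} (h : IsFinRank K) (c : ℂ) : IsFinRank (c • K) :=
  LinearMap.HasFiniteRange.smul h c

theorem IsFinRank.mul_left {K : X →L[ℂ] X} (h : IsFinRank K) (L : X →L[ℂ] X) : IsFinRank (L * K) :=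
  LinearMap.HasFiniteRange.comp_left h _

theorem IsFinRank.mul_right {K : X →L[ℂ] X} (h : IsFinRank K) (L : X →L[ℂ] X) :
    IsFinRank (K * L) :=
  LinearMap.HasFiniteRange.comp_right h _

theorem isFredholm_of_mul {B V : X →L[ℂ] X} (h1 : IsFinRank (V * B - 1))
    (h2 : IsFinRank (B * V - 1)) : B.IsFredholm :=
  ContinuousLinearMap.IsFredholm.of_isQuasiInverse (v := V)
    ⟨LinearMap.FiniteRangeSetoid.equiv_iff_hasFiniteRange.2 h1,
      LinearMap.FiniteRangeSetoid.equiv_iff_hasFiniteRange.2 h2⟩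

theorem exists_mul_of_isFredholm {B : X →L[ℂ] X} (h : B.IsFredholm) :
    ∃ V : X →L[ℂ] X, IsFinRank (V * B - 1) ∧ IsFinRank (B * V - 1) := by
  obtain ⟨V, h1, h2⟩ := h.exists_isQuasiInverse
  exact ⟨V, LinearMap.FiniteRangeSetoid.equiv_iff_hasFiniteRange.1 h1,
    LinearMap.FiniteRangeSetoid.equiv_iff_hasFiniteRange.1 h2⟩

theorem isFredholm_of_isUnit {B : X →L[ℂ] X} (h : IsUnit B) : B.IsFredholm := by
  obtain ⟨u, rfl⟩ := h
  refine isFredholm_of_mul (V := (↑u⁻¹ : X →L[ℂ] X)) ?_ ?_ <;> simp [IsFinRank]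

theorem isFredholm_of_sub {A B : X →L[ℂ] X} (h : A.IsFredholm) (hK : IsFinRank (B - A)) :
    B.IsFredholm := by
  obtain ⟨V, h1, h2⟩ := exists_mul_of_isFredholm h
  refine isFredholm_of_mul (V := V) ?_ ?_
  · have := h1.add (hK.mul_left V)
    rwa [show V * A - 1 + V * (B - A) = V * B - 1 by noncomm_ring] at this
  · have := h2.add (hK.mul_right V)
    rwa [show A * V - 1 + (B - A) * V = B * V - 1 by noncomm_ring] at this

theorem notMem_spectrum_iff {B : X →L[ℂ] X} {z : ℂ} :
    z ∉ spectrum ℂ B ↔ IsUnit (B - z • (1 : X →L[ℂ] X)) := by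
  rw [spectrum.notMem_iff, ← IsUnit.neg_iff, neg_sub, Algebra.algebraMap_eq_smul_one]

theorem ker_sub_smul_one (B : X →L[ℂ] X) (z : ℂ) :
    LinearMap.ker ((B - z • (1 : X →L[ℂ] X) : X →L[ℂ] X) : X →ₗ[ℂ] X) =
      Module.End.eigenspace (B : X →ₗ[ℂ] X) z := by
  ext x
  simp [sub_eq_zero]

theorem eigenspace_eq_bot {B : X →L[ℂ] X} {z : ℂ} (h : z ∉ spectrum ℂ B) :
    Module.End.eigenspace (B : X →ₗ[ℂ] X) z = ⊥ := by
  obtain ⟨u, hu⟩ := notMem_spectrum_iff.1 h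
  rw [← ker_sub_smul_one, ← hu, eq_bot_iff]
  intro x hx
  have hx' : (u : X →L[ℂ] X) x = 0 := hx
  have : ((↑u⁻¹ : X →L[ℂ] X) * u) x = 0 := by
    rw [mul_apply_eq_comp, hx', map_zero]
  simpa using this

theorem IsFinRank.isCompactOperator {K : X →L[ℂ] X} (h : IsFinRank K) : IsCompactOperator K := by
  have := isFinRank_iff.1 h
  let f : X →L[ℂ] LinearMap.range (K : X →ₗ[ℂ] X) := K.codRestrict _ fun x => ⟨x, rfl⟩
  have hf : IsCompactOperator (LinearMap.range (K : X →ₗ[ℂ] X)).subtypeL := by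
    have : ProperSpace (LinearMap.range (K : X →ₗ[ℂ] X)) := FiniteDimensional.proper ℂ _
    exact isCompactOperator_of_locallyCompactSpace_rng _
  exact hf.comp_clm f

variable [CompleteSpace X]

/-- The range is closed, and its orthogonal complement is the kernel. -/
theorem isUnit_of_isFredholm_of_injective {B : X →L[ℂ] X} (hB : IsSelfAdjoint B)
    (h : B.IsFredholm) (hi : ∀ x, B x = 0 → x = 0) : IsUnit B := by
  have hker : LinearMap.ker (B : X →ₗ[ℂ] X) = ⊥ := LinearMap.ker_eq_bot'.2 hi
  have hcl := h.isClosed_range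
  have : CompleteSpace (LinearMap.range (B : X →ₗ[ℂ] X)) := hcl.completeSpace_coe
  have hr : LinearMap.range (B : X →ₗ[ℂ] X) = ⊤ := by
    rw [← Submodule.orthogonal_eq_bot_iff, ← hker]
    exact ContinuousLinearMap.IsStarNormal.orthogonal_range hB.isStarNormal
  rw [ContinuousLinearMap.isUnit_iff_bijective]
  exact ⟨LinearMap.ker_eq_bot.1 hker, LinearMap.range_eq_top.1 hr⟩

theorem isSelfAdjoint_sub_smul_one {B : X →L[ℂ] X} (hB : IsSelfAdjoint B) (r : ℝ) :
    IsSelfAdjoint (B - (r : ℂ) • (1 : X →L[ℂ] X)) :=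
  hB.sub (IsSelfAdjoint.smul (Complex.conj_ofReal r) (IsSelfAdjoint.one _))

/-- Zero is isolated in the spectrum of a selfadjoint Fredholm operator. -/
theorem eventually_isUnit_sub_smul {C : X →L[ℂ] X} (hC : IsSelfAdjoint C) (hF : C.IsFredholm) :
    ∀ᶠ r : ℝ in 𝓝[≠] 0, IsUnit (C - (r : ℂ) • (1 : X →L[ℂ] X)) := by
  have := hF.finite_ker
  set k := LinearMap.ker (C : X →ₗ[ℂ] X) with hk
  set Q : X →L[ℂ] X := k.starProjection with hQ
  have hQf : IsFinRank Q := IsFinRank.of_forall_mem (F := k) fun x => k.starProjection_apply_mem x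
  have hQs : IsSelfAdjoint Q := isSelfAdjoint_starProjection k
  have hCQ : C * Q = 0 := by
    ext x; exact k.starProjection_apply_mem x
  have hQC : Q * C = 0 := by
    have := congrArg star hCQ
    rwa [star_mul, hC.star_eq, hQs.star_eq, star_zero] at this
  have hQQ : Q * Q = Q := k.isIdempotentElem_starProjection
  -- Adding the projection onto the kernel makes C invertible, and invertibility persists for C + Q
  -- − r with r small. Then C − r is Fredholm; for r ≠ 0 its kernel is killed by Q because QC = 0,
  -- hence is zero.
  have hD : IsUnit (C + Q) := by
    refine isUnit_of_isFredholm_of_injective (hC.add hQs)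
      (isFredholm_of_sub hF (by simpa using hQf)) fun x hx => ?_
    have h1 : Q x = 0 := by
      have : (Q * (C + Q)) x = 0 := by rw [mul_apply_eq_comp, hx, map_zero]
      rwa [mul_add, hQC, hQQ, zero_add] at this
    have h2 : C x = 0 := by
      rwa [add_apply, h1, add_zero] at hx
    rwa [hQ, Submodule.starProjection_eq_self_iff.2 (show x ∈ k from h2)] at h1
  have hcont : Continuous fun r : ℝ => C + Q - (r : ℂ) • (1 : X →L[ℂ] X) := by fun_prop
  have hev : ∀ᶠ r : ℝ in 𝓝 0, IsUnit (C + Q - (r : ℂ) • (1 : X →L[ℂ] X)) :=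
    (hcont.tendsto 0).eventually (Units.isOpen.mem_nhds (by simpa using hD))
  filter_upwards [nhdsWithin_le_nhds hev, self_mem_nhdsWithin] with r hr hr0
  refine isUnit_of_isFredholm_of_injective (isSelfAdjoint_sub_smul_one hC r)
    (isFredholm_of_sub (isFredholm_of_isUnit hr) ?_) fun x hx => ?_
  · rw [show C - (r : ℂ) • (1 : X →L[ℂ] X) - (C + Q - (r : ℂ) • (1 : X →L[ℂ] X)) = -Q by abel]
    exact hQf.neg
  · have h1 : Q x = 0 := by
      have : (Q * (C - (r : ℂ) • (1 : X →L[ℂ] X))) x = 0 := by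
        rw [mul_apply_eq_comp, hx, map_zero]
      rw [mul_sub, hQC] at this
      have hr0' : r ≠ 0 := hr0
      simpa [hr0'] using this
    obtain ⟨u, hu⟩ := hr
    have h2 : (u : X →L[ℂ] X) x = 0 := by
      rw [hu, add_sub_right_comm, add_apply, hx, h1, add_zero]
    have : ((↑u⁻¹ : X →L[ℂ] X) * u) x = 0 := by
      rw [mul_apply_eq_comp, h2, map_zero]
    simpa using this

theorem eventually_notMem_spectrum {B : X →L[ℂ] X} (hB : IsSelfAdjoint B) {r₀ : ℝ}
    (hF : (B - (r₀ : ℂ) • (1 : X →L[ℂ] X)).IsFredholm) :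
    ∀ᶠ r : ℝ in 𝓝[≠] r₀, (r : ℂ) ∉ spectrum ℂ B := by
  have h1 := eventually_isUnit_sub_smul (isSelfAdjoint_sub_smul_one hB r₀) hF
  have h2 : Tendsto (fun r : ℝ => r - r₀) (𝓝[≠] r₀) (𝓝[≠] 0) := by
    refine tendsto_nhdsWithin_iff.2 ⟨?_, ?_⟩
    · have : Continuous fun r : ℝ => r - r₀ := by fun_prop
      exact ((this.tendsto r₀).mono_left nhdsWithin_le_nhds).trans (by simp)
    · filter_upwards [self_mem_nhdsWithin] with r hr
      simpa [sub_eq_zero] using hr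
  filter_upwards [h2.eventually h1] with r hr
  rw [notMem_spectrum_iff]
  convert hr using 1
  rw [sub_sub, ← add_smul]
  simp

/-- Functional calculus with (x − r₀)⁻¹, read as 0 at r₀, gives V commuting with B − r₀ such that
V(B − r₀) − 1 maps into the eigenspace of r₀. So V is an inverse modulo finite rank. -/
theorem isFredholm_of_eventually_notMem_spectrum {B : X →L[ℂ] X} (hB : IsSelfAdjoint B) {r₀ : ℝ}
    (hev : ∀ᶠ r : ℝ in 𝓝[≠] r₀, (r : ℂ) ∉ spectrum ℂ B)
    (hfin : FiniteDimensional ℂ (Module.End.eigenspace (B : X →ₗ[ℂ] X) (r₀ : ℂ))) :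
    (B - (r₀ : ℂ) • (1 : X →L[ℂ] X)).IsFredholm := by
  have hspec : ∀ r : ℝ, (r : ℂ) ∉ spectrum ℂ B → r ∉ spectrum ℝ B := fun r hr hr' =>
    hr (spectrum.algebraMap_mem ℂ hr')
  set g : ℝ → ℝ := fun x => (x - r₀)⁻¹ with hg
  set h : ℝ → ℝ := fun x => x - r₀ with hh
  have hgc : ContinuousOn g (spectrum ℝ B) := by
    intro x hx
    by_cases hxr : x = r₀
    · subst hxr
      -- Within the spectrum r₀ is isolated, so any value of g there is continuous.
      have : 𝓝[spectrum ℝ B] x ≤ pure x := by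
        intro s hs
        rw [mem_pure] at hs
        rw [eventually_nhdsWithin_iff] at hev
        rw [mem_nhdsWithin_iff_eventually]
        filter_upwards [hev] with r hr hrs
        by_cases hrx : r = x
        · rwa [hrx]
        · exact absurd hrs (hspec r (hr hrx))
      exact Filter.Tendsto.mono_left (tendsto_pure_nhds g x) this
    · exact (ContinuousAt.inv₀ (f := h) (by fun_prop) (sub_ne_zero.2 hxr)).continuousWithinAt
  have hhc : ContinuousOn h (spectrum ℝ B) := by fun_prop
  have hhB : cfc h B = B - (r₀ : ℂ) • (1 : X →L[ℂ] X) := by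
    rw [hh, cfc_sub (fun x : ℝ => x) (fun _ => r₀) B, cfc_id' ℝ B, cfc_const r₀ B,
      Algebra.algebraMap_eq_smul_one, Complex.coe_smul]
  set V := cfc g B with hV
  have hcomm : V * (B - (r₀ : ℂ) • (1 : X →L[ℂ] X)) = (B - (r₀ : ℂ) • (1 : X →L[ℂ] X)) * V := by
    rw [← hhB, hV, ← cfc_mul g h B, ← cfc_mul h g B]
    simp only [mul_comm]
  have hzero : (B - (r₀ : ℂ) • (1 : X →L[ℂ] X)) *
      (V * (B - (r₀ : ℂ) • (1 : X →L[ℂ] X)) - 1) = 0 := by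
    rw [mul_sub, mul_one, ← hhB, hV, ← cfc_mul g h B,
      ← cfc_mul h (fun x => g x * h x) B hhc (hgc.mul hhc), sub_eq_zero]
    congr 1
    funext x
    simp only [hg, hh]
    by_cases hx : x - r₀ = 0
    · simp [hx]
    · field_simp
  rw [← ker_sub_smul_one] at hfin
  have h1 : IsFinRank (V * (B - (r₀ : ℂ) • (1 : X →L[ℂ] X)) - 1) :=
    IsFinRank.of_forall_mem (F := LinearMap.ker
      ((B - (r₀ : ℂ) • (1 : X →L[ℂ] X) : X →L[ℂ] X) : X →ₗ[ℂ] X)) fun x => by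
        have := congrArg (fun T : X →L[ℂ] X => T x) hzero
        exact this
  exact isFredholm_of_mul h1 (hcomm ▸ h1)

theorem finite_spectrum_of_isFredholm {B : X →L[ℂ] X} (hB : IsSelfAdjoint B) {a b : ℝ}
    (h : ∀ r ∈ Set.Icc a b, (B - (r : ℂ) • (1 : X →L[ℂ] X)).IsFredholm) :
    {r : ℝ | r ∈ Set.Icc a b ∧ (r : ℂ) ∈ spectrum ℂ B}.Finite := by
  by_contra hinf
  obtain ⟨x, hx, hacc⟩ := Set.Infinite.exists_accPt_of_subset_isCompact hinf
    (isCompact_Icc (a := a) (b := b)) fun r hr => hr.1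
  have h1 := eventually_notMem_spectrum hB (h x hx)
  rw [accPt_iff_frequently_nhdsNE] at hacc
  exact hacc (h1.mono fun r hr hr' => hr hr'.2)

/-- Replaces the condition on eigenvalues by a Fredholm condition, which is stable under finite rank
perturbation. -/
theorem isAdmissibleLevel_iff {B : X →L[ℂ] X} (hB : IsSelfAdjoint B) {e : ℝ} :
    IsAdmissibleLevel B e ↔ 0 < e ∧ (e : ℂ) ∉ spectrum ℂ B ∧ ((-e : ℝ) : ℂ) ∉ spectrum ℂ B ∧
      ∀ r ∈ Set.Icc (-e) e, (B - (r : ℂ) • (1 : X →L[ℂ] X)).IsFredholm := by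
  constructor
  · rintro ⟨h0, h1, h2, h3, h4⟩
    refine ⟨h0, h1, h2, fun r hr => ?_⟩
    by_cases hr1 : r = e
    · exact isFredholm_of_isUnit (notMem_spectrum_iff.1 (hr1 ▸ h1))
    by_cases hr2 : r = -e
    · exact isFredholm_of_isUnit (notMem_spectrum_iff.1 (hr2 ▸ h2))
    refine isFredholm_of_eventually_notMem_spectrum hB ?_ (h4 r hr)
    have hI : ∀ᶠ x in 𝓝 r, x ∈ Set.Icc (-e) e :=
      Icc_mem_nhds (lt_of_le_of_ne hr.1 (Ne.symm hr2)) (lt_of_le_of_ne hr.2 hr1)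
    have hZ : ∀ᶠ x in 𝓝[≠] r,
        x ∉ {r : ℝ | r ∈ Set.Icc (-e) e ∧ (r : ℂ) ∈ spectrum ℂ B} \ {r} :=
      nhdsWithin_le_nhds ((h3.subset Set.sdiff_subset).isClosed.isOpen_compl.mem_nhds (by simp))
    filter_upwards [nhdsWithin_le_nhds hI, hZ, self_mem_nhdsWithin] with x hx hx' hx'' hxs
    exact hx' ⟨⟨hx, hxs⟩, hx''⟩
  · rintro ⟨h0, h1, h2, h3⟩
    refine ⟨h0, h1, h2, finite_spectrum_of_isFredholm hB h3, fun r hr => ?_⟩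
    rw [← ker_sub_smul_one]
    exact (h3 r hr).finite_ker

end Operators

/-! ### Dimension of finite sums of eigenspaces. -/

section Eigenspaces

variable {X : Type*} [NormedAddCommGroup X] [InnerProductSpace ℂ X]

theorem finrank_biSup_of_iSupIndep {ι : Type*} {E : ι → Submodule ℂ X} (hE : iSupIndep E)
    (Z : Finset ι) (hfin : ∀ i ∈ Z, FiniteDimensional ℂ (E i)) :
    FiniteDimensional ℂ ↥(⨆ i ∈ Z, E i) ∧
      Module.finrank ℂ ↥(⨆ i ∈ Z, E i) = ∑ i ∈ Z, Module.finrank ℂ (E i) := by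
  classical
  induction Z using Finset.induction_on with
  | empty =>
    have h : ⨆ i ∈ (∅ : Finset ι), E i = ⊥ := by simp
    rw [h]
    exact ⟨inferInstance, by simp⟩
  | insert i Z hi ih =>
    obtain ⟨h1, h2⟩ := ih fun j hj => hfin j (Finset.mem_insert_of_mem hj)
    have h3 := hfin i (Finset.mem_insert_self i Z)
    rw [Finset.iSup_insert, Finset.sum_insert hi, ← h2]
    have hd : Disjoint (E i) (⨆ j ∈ Z, E j) :=
      (hE i).mono_right (biSup_mono fun j hj => by rintro rfl; exact hi hj)
    exact ⟨inferInstance, finrank_sup_of_disjoint hd⟩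

theorem iSupIndep_eigenspace_ofReal (B : X →L[ℂ] X) :
    iSupIndep fun r : ℝ => Module.End.eigenspace (B : X →ₗ[ℂ] X) (r : ℂ) :=
  (Module.End.eigenspaces_iSupIndep (B : X →ₗ[ℂ] X)).comp Complex.ofReal_injective

theorem biSup_eigenspace_eq {B : X →L[ℂ] X} {I : Set ℝ} {Z : Finset ℝ}
    (hZ : ∀ r, r ∈ Z ↔ r ∈ I ∧ (r : ℂ) ∈ spectrum ℂ B) :
    ⨆ r ∈ I, Module.End.eigenspace (B : X →ₗ[ℂ] X) (r : ℂ) =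
      ⨆ r ∈ Z, Module.End.eigenspace (B : X →ₗ[ℂ] X) (r : ℂ) := by
  apply le_antisymm
  · refine iSup₂_le fun r hr => ?_
    by_cases hs : (r : ℂ) ∈ spectrum ℂ B
    · exact le_iSup₂_of_le r ((hZ r).2 ⟨hr, hs⟩) le_rfl
    · rw [eigenspace_eq_bot hs]; exact bot_le
  · exact biSup_mono fun r hr => ((hZ r).1 hr).1

end Eigenspaces

/-! ### Transport of the negative index along linear maps. -/

section MapIndex

variable {V V' : Type*} [AddCommGroup V] [Module ℂ V] [AddCommGroup V'] [Module ℂ V']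

theorem finrank_map_of_injOn (T : V →ₗ[ℂ] V') {W : Submodule ℂ V}
    (hT : ∀ x ∈ W, T x = 0 → x = 0) : Module.finrank ℂ (W.map T) = Module.finrank ℂ W := by
  rw [← LinearMap.range_domRestrict]
  refine LinearMap.finrank_range_of_inj (LinearMap.ker_eq_bot.1 (LinearMap.ker_eq_bot'.2 ?_))
  intro x hx
  exact Subtype.ext (hT x x.2 hx)

/-- The negative index is invariant under linear isomorphisms. -/
theorem negIdx_map {J : V →ₗ⋆[ℂ] V →ₗ[ℂ] ℂ} {J' : V' →ₗ⋆[ℂ] V' →ₗ[ℂ] ℂ} (T : V →ₗ[ℂ] V')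
    {F : Submodule ℂ V} [FiniteDimensional ℂ F] (hT : ∀ x ∈ F, T x = 0 → x = 0)
    (hJ : ∀ x ∈ F, (J' (T x) (T x)).re = (J x x).re) : negIdx J' (F.map T) = negIdx J F := by
  apply le_antisymm
  · obtain ⟨W, hW, hneg, hn⟩ := exists_finrank_eq_negIdx J' (F.map T)
    rw [← hn]
    have hWm : (F ⊓ W.comap T).map T = W := by
      ext y
      constructor
      · rintro ⟨x, hx, rfl⟩; exact hx.2
      · intro hy
        obtain ⟨x, hx, rfl⟩ := hW hy
        exact ⟨x, ⟨hx, hy⟩, rfl⟩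
    rw [← hWm, finrank_map_of_injOn (W := F ⊓ W.comap T) T fun x hx => hT x hx.1]
    refine NegDefOn.finrank_le_negIdx inf_le_left fun x hx hx0 => ?_
    rw [← hJ x hx.1]
    exact hneg _ hx.2 fun h => hx0 (hT x hx.1 h)
  · obtain ⟨W, hW, hneg, hn⟩ := exists_finrank_eq_negIdx J F
    rw [← hn, ← finrank_map_of_injOn T fun x hx => hT x (hW hx)]
    refine NegDefOn.finrank_le_negIdx (Submodule.map_mono hW) ?_
    rintro _ ⟨x, hx, rfl⟩ hx0
    rw [hJ x (hW hx)]
    exact hneg x hx fun h => hx0 (by simp [h])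

theorem negIdx_congr {J J' : V →ₗ⋆[ℂ] V →ₗ[ℂ] ℂ} {F : Submodule ℂ V} [FiniteDimensional ℂ F]
    (h : ∀ x ∈ F, (J' x x).re = (J x x).re) : negIdx J' F = negIdx J F := by
  simpa using negIdx_map (J := J) (J' := J') LinearMap.id (fun x _ hx => hx) h

end MapIndex

/-! ### The negative index under small and under monotone perturbations. -/

section Perturbation

variable {X : Type*} [NormedAddCommGroup X] [InnerProductSpace ℂ X]

theorem opForm_apply (A : X →L[ℂ] X) (x y : X) : opForm A x y = inner ℂ (A x) y :=
  rfl

theorem re_inner_self (x : X) : (inner ℂ x x).re = ‖x‖ ^ 2 := inner_self_eq_norm_sq (𝕜 := ℂ) x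

theorem abs_re_inner_le (x y : X) : |(inner ℂ x y).re| ≤ ‖x‖ * ‖y‖ :=
  (Complex.abs_re_le_norm _).trans (norm_inner_le_norm x y)

theorem opForm_neg (A : X →L[ℂ] X) : opForm (-A) = -opForm A := by
  ext x y
  simp [opForm_apply]

theorem NegDefOn.exists_le {S : X →L[ℂ] X} {W : Submodule ℂ X} [FiniteDimensional ℂ W]
    (h : NegDefOn (opForm S) W) :
    ∃ c > 0, ∀ x ∈ W, (opForm S x x).re ≤ -c * ‖x‖ ^ 2 := by
  have : ProperSpace W := FiniteDimensional.proper ℂ W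
  rcases (Metric.sphere (0 : W) 1).eq_empty_or_nonempty with he | hne
  · refine ⟨1, one_pos, fun x hx => ?_⟩
    by_cases hx0 : x = 0
    · simp [hx0]
    · exfalso
      have : (⟨((‖x‖⁻¹ : ℝ) : ℂ) • x, W.smul_mem _ hx⟩ : W) ∈ Metric.sphere (0 : W) 1 := by
        have := norm_ne_zero_iff.2 hx0
        simp [norm_smul, this]
      rw [he] at this
      exact this
  · have hc : Continuous fun x : W => (opForm S (x : X) (x : X)).re := by
      simp only [opForm_apply]
      exact Complex.continuous_re.comp
        ((S.continuous.comp continuous_subtype_val).inner continuous_subtype_val)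
    obtain ⟨x₀, hx₀, hmax⟩ := (isCompact_sphere (0 : W) 1).exists_isMaxOn hne hc.continuousOn
    have hx₀' : x₀ ≠ 0 := by rintro rfl; simp at hx₀
    refine ⟨-(opForm S (x₀ : X) (x₀ : X)).re,
      by simpa using h x₀ x₀.2 (by simpa using hx₀'), fun x hx => ?_⟩
    by_cases hx0 : x = 0
    · simp [hx0]
    · have hnx := norm_ne_zero_iff.2 hx0
      have hm : (⟨((‖x‖⁻¹ : ℝ) : ℂ) • x, W.smul_mem _ hx⟩ : W) ∈ Metric.sphere (0 : W) 1 := by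
        simp [norm_smul, hnx]
      have h1 := hmax hm
      simp only [Set.mem_ofPred_eq, re_smul_smul] at h1
      rw [Complex.norm_real, norm_inv, norm_norm] at h1
      rw [neg_neg]
      have h2 := mul_le_mul_of_nonneg_left h1 (sq_nonneg ‖x‖)
      rw [← mul_assoc, ← mul_pow, mul_inv_cancel₀ hnx, one_pow, one_mul] at h2
      linarith

/-- Lower semicontinuity of the negative index. -/
theorem eventually_negIdx_le {ι : Type*} {l : Filter ι} {S : ι → X →L[ℂ] X} {S₀ : X →L[ℂ] X}
    (h : Tendsto S l (𝓝 S₀)) (F : Submodule ℂ X) [FiniteDimensional ℂ F] :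
    ∀ᶠ i in l, negIdx (opForm S₀) F ≤ negIdx (opForm (S i)) F := by
  obtain ⟨W, hW, hneg, hn⟩ := exists_finrank_eq_negIdx (opForm S₀) F
  have := Submodule.finiteDimensional_of_le hW
  obtain ⟨c, hc, hle⟩ := hneg.exists_le
  filter_upwards [h.eventually (Metric.ball_mem_nhds S₀ hc)] with i hi
  rw [← hn]
  refine NegDefOn.finrank_le_negIdx hW fun x hx hx0 => ?_
  have h1 := hle x hx
  have h2 : (opForm (S i) x x).re = (opForm S₀ x x).re + (inner ℂ ((S i - S₀) x) x).re := by
    simp [opForm_apply]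
  have h3 := (le_abs_self _).trans (abs_re_inner_le ((S i - S₀) x) x)
  have h4 : ‖(S i - S₀) x‖ ≤ ‖S i - S₀‖ * ‖x‖ := (S i - S₀).le_opNorm x
  rw [dist_eq_norm] at hi
  have h5 : 0 < ‖x‖ := norm_pos_iff.2 hx0
  have h6 : ‖(S i - S₀) x‖ * ‖x‖ ≤ ‖S i - S₀‖ * ‖x‖ * ‖x‖ := by gcongr
  have h7 : ‖S i - S₀‖ * ‖x‖ * ‖x‖ < c * ‖x‖ * ‖x‖ := by gcongr
  rw [h2]
  nlinarith

variable [CompleteSpace X]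

theorem inner_apply_comm_of_isSelfAdjoint {A : X →L[ℂ] X} (hA : IsSelfAdjoint A) (x y : X) :
    inner ℂ (A x) y = inner ℂ x (A y) :=
  (ContinuousLinearMap.isSelfAdjoint_iff_isSymmetric.1 hA) x y

theorem isHermForm_opForm {A : X →L[ℂ] X} (hA : IsSelfAdjoint A) : IsHermForm (opForm A) :=
  fun x y => by
    rw [opForm_apply, opForm_apply, inner_conj_symm, inner_apply_comm_of_isSelfAdjoint hA]

/-- Semicontinuity for S and for −S; at a nondegenerate limit the two indices already fill F, so
neither can increase. -/
theorem eventually_negIdx_eq {ι : Type*} {l : Filter ι} {S : ι → X →L[ℂ] X} {S₀ : X →L[ℂ] X}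
    (h : Tendsto S l (𝓝 S₀)) (hS : ∀ᶠ i in l, IsSelfAdjoint (S i)) (hS₀ : IsSelfAdjoint S₀)
    (F : Submodule ℂ X) [FiniteDimensional ℂ F]
    (hr : Module.finrank ℂ (rad (opForm S₀) F) = 0) :
    ∀ᶠ i in l, negIdx (opForm (S i)) F = negIdx (opForm S₀) F := by
  have h2 := eventually_negIdx_le h.neg F
  filter_upwards [eventually_negIdx_le h F, h2, hS] with i h1 h2 h3
  rw [opForm_neg, opForm_neg] at h2
  have e1 := negIdx_add_negIdx_neg_add_rad (isHermForm_opForm h3) F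
  have e2 := negIdx_add_negIdx_neg_add_rad (isHermForm_opForm hS₀) F
  omega

/-- On a maximal negative subspace plus the radical, S₀ is nonpositive, so the strictly smaller S is
negative definite. -/
theorem negIdx_add_rad_le {S S₀ : X →L[ℂ] X} (hS₀ : IsSelfAdjoint S₀) (F : Submodule ℂ X)
    [FiniteDimensional ℂ F]
    (h : ∀ x ∈ F, x ≠ 0 → (opForm S x x).re < (opForm S₀ x x).re) :
    negIdx (opForm S₀) F + Module.finrank ℂ (rad (opForm S₀) F) ≤ negIdx (opForm S) F := by
  have hJ := isHermForm_opForm hS₀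
  obtain ⟨W, hW, hneg, hn⟩ := exists_finrank_eq_negIdx (opForm S₀) F
  have := Submodule.finiteDimensional_of_le hW
  have := Submodule.finiteDimensional_of_le (rad_le (J := opForm S₀) (H := F))
  have hd : Disjoint W (rad (opForm S₀) F) :=
    hneg.disjoint fun x hx => by rw [hx.2 x hx.1]; simp
  rw [← hn, ← finrank_sup_of_disjoint hd]
  refine NegDefOn.finrank_le_negIdx (sup_le hW rad_le) fun x hx hx0 => ?_
  refine (h x (sup_le hW rad_le hx) hx0).trans_le ?_
  obtain ⟨w, hw, r, hr, rfl⟩ := Submodule.mem_sup.1 hx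
  rw [hJ.re_add, hr.2 r hr.1, hJ.eq_zero_symm (hr.2 w (hW hw))]
  by_cases hw0 : w = 0
  · simp [hw0]
  · simpa using (hneg w hw hw0).le

/-- Behaviour of the negative index of a strictly decreasing family on both sides of a point. -/
theorem eventually_negIdx_jump {S : ℝ → X →L[ℂ] X} {z₀ : ℝ} {l : Filter ℝ}
    (h : Tendsto S l (𝓝 (S z₀))) (hS : ∀ᶠ z in l, IsSelfAdjoint (S z))
    (hS₀ : IsSelfAdjoint (S z₀)) (F : Submodule ℂ X) [FiniteDimensional ℂ F]
    (hmono : ∀ᶠ z in l, ∀ x ∈ F, x ≠ 0 → ∃ q > 0,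
      (opForm (S z₀) x x).re - (opForm (S z) x x).re = (z - z₀) * q) :
    ∀ᶠ z in l, negIdx (opForm (S z)) F = negIdx (opForm (S z₀)) F +
      if z₀ < z then Module.finrank ℂ (rad (opForm (S z₀)) F) else 0 := by
  filter_upwards [eventually_negIdx_le h F, eventually_negIdx_le h.neg F, hS, hmono]
    with z h1 h2 h3 h4
  rw [opForm_neg, opForm_neg] at h2
  have e1 := negIdx_add_negIdx_neg_add_rad (isHermForm_opForm h3) F
  have e2 := negIdx_add_negIdx_neg_add_rad (isHermForm_opForm hS₀) F
  -- To the right of z₀ the whole radical turns negative, and semicontinuity of the positive index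
  -- forbids more. To the left the roles of z and z₀ are exchanged, so the index does not change.
  rcases lt_trichotomy z₀ z with hz | hz | hz
  · rw [if_pos hz]
    have := negIdx_add_rad_le (S := S z) hS₀ F fun x hx hx0 => by
      obtain ⟨q, hq, hq'⟩ := h4 x hx hx0
      have := mul_pos (sub_pos.2 hz) hq
      linarith
    omega
  · simp [hz]
  · rw [if_neg hz.not_gt, add_zero]
    have := negIdx_add_rad_le (S := S z₀) h3 F fun x hx hx0 => by
      obtain ⟨q, hq, hq'⟩ := h4 x hx hx0
      have := mul_pos (sub_pos.2 hz) hq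
      linarith
    omega

end Perturbation

/-! ### Schur complements: nullity and negative index. -/

section Schur

variable {X : Type*} [NormedAddCommGroup X] [InnerProductSpace ℂ X] [CompleteSpace X]

/-- `R` is the inverse of the compression of `C` to the range of the projection `Q`, extended by
zero. -/
structure IsCompressionInverse (C Q R : X →L[ℂ] X) : Prop where
  isSelfAdjoint : IsSelfAdjoint C
  isSelfAdjoint_proj : IsSelfAdjoint Q
  isSelfAdjoint_inv : IsSelfAdjoint R
  proj_mul : Q * R = R
  proj_mul_mul : Q * C * R = Q

/-- The Schur complement of `C` with respect to the inverse `R` of a compression. -/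
noncomputable def schur (C R : X →L[ℂ] X) : X →L[ℂ] X := C - C * R * C

namespace IsCompressionInverse

variable {C Q R : X →L[ℂ] X}

theorem mul_proj (h : IsCompressionInverse C Q R) : R * Q = R := by
  have := congrArg star h.proj_mul
  rwa [star_mul, h.isSelfAdjoint_inv.star_eq, h.isSelfAdjoint_proj.star_eq] at this

theorem mul_mul_proj (h : IsCompressionInverse C Q R) : R * C * Q = Q := by
  have := congrArg star h.proj_mul_mul
  rwa [star_mul, star_mul, h.isSelfAdjoint_inv.star_eq, h.isSelfAdjoint_proj.star_eq,
    h.isSelfAdjoint.star_eq, ← mul_assoc] at this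

theorem proj_mul_proj (h : IsCompressionInverse C Q R) : Q * Q = Q := by
  nth_rewrite 1 [← h.proj_mul_mul]
  rw [mul_assoc, h.mul_proj, h.proj_mul_mul]

theorem isSelfAdjoint_schur (h : IsCompressionInverse C Q R) : IsSelfAdjoint (schur C R) := by
  refine h.isSelfAdjoint.sub ?_
  rw [IsSelfAdjoint, star_mul, star_mul, h.isSelfAdjoint_inv.star_eq, h.isSelfAdjoint.star_eq,
    mul_assoc]

theorem proj_mul_schur (h : IsCompressionInverse C Q R) : Q * schur C R = 0 := by
  rw [schur, mul_sub, ← mul_assoc, ← mul_assoc, h.proj_mul_mul, sub_self]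

theorem schur_mul_proj (h : IsCompressionInverse C Q R) : schur C R * Q = 0 := by
  rw [schur, sub_mul, mul_assoc (C * R), mul_assoc C, ← mul_assoc R, h.mul_mul_proj, sub_self]

theorem inv_apply_eq_zero (h : IsCompressionInverse C Q R) {x : X} (hx : Q x = 0) : R x = 0 := by
  rw [← h.mul_proj, mul_apply_eq_comp, hx, map_zero]

theorem mem_rad_schur_iff (h : IsCompressionInverse C Q R) {F : Submodule ℂ X}
    (hF : ∀ x, x ∈ F ↔ Q x = 0) {x : X} :
    x ∈ rad (opForm (schur C R)) F ↔ Q x = 0 ∧ schur C R x = 0 := by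
  refine ⟨fun hx => ⟨(hF x).1 hx.1, ?_⟩, fun hx => ⟨(hF x).2 hx.1, fun y _ => ?_⟩⟩
  · have h1 : schur C R x ∈ F :=
      (hF _).2 (congrArg (fun T : X →L[ℂ] X => T x) h.proj_mul_schur)
    exact inner_self_eq_zero.1 (hx.2 _ h1)
  · rw [opForm_apply, hx.2, inner_zero_left]

/-- The Schur complement has the same nullity as the operator. -/
theorem finrank_rad_schur (h : IsCompressionInverse C Q R) {F : Submodule ℂ X}
    (hF : ∀ x, x ∈ F ↔ Q x = 0) :
    Module.finrank ℂ (rad (opForm (schur C R)) F) =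
      Module.finrank ℂ (LinearMap.ker (C : X →ₗ[ℂ] X)) := by
  -- The map 1 − Q carries ker C onto the radical, with inverse x ↦ x − R C x.
  have hmap : rad (opForm (schur C R)) F =
      (LinearMap.ker (C : X →ₗ[ℂ] X)).map ((1 - Q : X →L[ℂ] X) : X →ₗ[ℂ] X) := by
    have hQQ := h.proj_mul_proj
    ext x
    rw [h.mem_rad_schur_iff hF]
    constructor
    · rintro ⟨hx, hs⟩
      refine ⟨x - R (C x), ?_, ?_⟩
      · have : schur C R x = C (x - R (C x)) := by simp [schur]
        rw [this] at hs
        exact hs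
      · have h1 : Q (R (C x)) = R (C x) := by
          rw [← mul_apply_eq_comp, h.proj_mul]
        simp [hx, h1]
    · rintro ⟨y, hy, rfl⟩
      have hy' : C y = 0 := hy
      refine ⟨?_, ?_⟩
      · have : (Q * (1 - Q)) y = 0 := by rw [mul_sub, mul_one, hQQ, sub_self]; rfl
        exact this
      · have : (schur C R * (1 - Q)) y = schur C R y := by
          rw [mul_sub, h.schur_mul_proj, mul_one, sub_zero]
        refine this.trans ?_
        simp [schur, hy']
  rw [hmap]
  refine finrank_map_of_injOn _ fun x hx hx0 => ?_
  have hx' : C x = 0 := hx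
  have hxQ : x = Q x := sub_eq_zero.1 hx0
  have : (R * C * Q) x = Q x := by rw [h.mul_mul_proj]
  rw [mul_apply_eq_comp, ← hxQ, mul_apply_eq_comp, hx', map_zero] at this
  exact this.symm

/-- The negative index of the Schur complement is that of the form on the orthogonal complement of
the range of `Q`. -/
theorem negIdx_schur (h : IsCompressionInverse C Q R) {F : Submodule ℂ X} [FiniteDimensional ℂ F]
    (hF : ∀ x, x ∈ F ↔ Q x = 0) {Y : Submodule ℂ X} (hY : ∀ x, x ∈ Y ↔ Q (C x) = 0) :
    FiniteDimensional ℂ Y ∧ negIdx (opForm (schur C R)) F = negIdx (opForm C) Y := by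
  -- Block elimination: 1 − RC maps F isomorphically onto Y and pulls the form of C back to the
  -- Schur form.
  have hYF : Y = F.map ((1 - R * C : X →L[ℂ] X) : X →ₗ[ℂ] X) := by
    ext y
    constructor
    · intro hy
      have hQC := (hY y).1 hy
      refine ⟨y - Q y, (hF _).2 ?_, ?_⟩
      · rw [map_sub, ← mul_apply_eq_comp, h.proj_mul_proj, sub_self]
      · have h1 : R (C (Q y)) = Q y := congrArg (fun T : X →L[ℂ] X => T y) h.mul_mul_proj
        have h2 : R (C y) = 0 := h.inv_apply_eq_zero hQC
        simp [h1, h2]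
    · rintro ⟨x, hx, rfl⟩
      rw [hY]
      have := congrArg (fun T : X →L[ℂ] X => T x) h.proj_mul_schur
      simpa [schur] using this
  subst hYF
  refine ⟨inferInstance, (negIdx_map _ (fun x hx hx0 => ?_) fun x hx => ?_).symm⟩
  · have h1 : x = R (C x) := sub_eq_zero.1 hx0
    have h2 : Q x = 0 := (hF x).1 hx
    have h3 : Q (R (C x)) = R (C x) := by rw [← mul_apply_eq_comp, h.proj_mul]
    rw [h1, ← h3, ← h1, h2]
  · have h1 : C ((1 - R * C : X →L[ℂ] X) x) = schur C R x := by simp [schur]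
    have h2 : R (schur C R x) = 0 :=
      h.inv_apply_eq_zero (congrArg (fun T : X →L[ℂ] X => T x) h.proj_mul_schur)
    simp only [opForm_apply, ContinuousLinearMap.coe_coe, h1]
    have h3 : ((1 - R * C : X →L[ℂ] X) x) = x - R (C x) := by simp
    rw [h3, inner_sub_right, ← inner_apply_comm_of_isSelfAdjoint h.isSelfAdjoint_inv, h2,
      inner_zero_left,
      sub_zero]

end IsCompressionInverse

end Schur

/-! ### Counting eigenvalues by the index of the Schur complement. -/

section Jump

variable {X : Type*} [NormedAddCommGroup X] [InnerProductSpace ℂ X]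

theorem nonnegCount_eq_sum {B : X →L[ℂ] X} {e : ℝ} (hadm : IsAdmissibleLevel B e) {Z : Finset ℝ}
    (hZ : ∀ r, r ∈ Z ↔ r ∈ Set.Icc 0 e ∧ (r : ℂ) ∈ spectrum ℂ B) :
    nonnegCount B e =
      ∑ r ∈ Z, Module.finrank ℂ (Module.End.eigenspace (B : X →ₗ[ℂ] X) (r : ℂ)) := by
  rw [nonnegCount, biSup_eigenspace_eq hZ]
  refine (finrank_biSup_of_iSupIndep (iSupIndep_eigenspace_ofReal B) Z fun r hr => ?_).2
  have := ((hZ r).1 hr).1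
  exact hadm.2.2.2.2 r ⟨by linarith [this.1, hadm.1], this.2⟩

variable [CompleteSpace X]

theorem IsCompressionInverse.resolvent_identity {B Q R R' : X →L[ℂ] X} {z w : ℝ}
    (h : IsCompressionInverse (B - (z : ℂ) • (1 : X →L[ℂ] X)) Q R)
    (h' : IsCompressionInverse (B - (w : ℂ) • (1 : X →L[ℂ] X)) Q R') :
    R - R' = ((z - w : ℝ) : ℂ) • (R * R') := by
  have h1 : R = R * (Q * (B - (w : ℂ) • (1 : X →L[ℂ] X)) * R') := by
    rw [h'.proj_mul_mul, h.mul_proj]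
  have h2 : R' = (R * (B - (z : ℂ) • (1 : X →L[ℂ] X)) * Q) * R' := by
    rw [h.mul_mul_proj, h'.proj_mul]
  have h3 : R - R' = R * (Q * (B - (w : ℂ) • (1 : X →L[ℂ] X)) * R') -
      (R * (B - (z : ℂ) • (1 : X →L[ℂ] X)) * Q) * R' := by rw [← h1, ← h2]
  have h4 : R * (Q * (B - (w : ℂ) • (1 : X →L[ℂ] X)) * R') =
      R * (B - (w : ℂ) • (1 : X →L[ℂ] X)) * R' := by
    rw [← mul_assoc, ← mul_assoc, h.mul_proj]
  have h5 : (R * (B - (z : ℂ) • (1 : X →L[ℂ] X)) * Q) * R' =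
      R * (B - (z : ℂ) • (1 : X →L[ℂ] X)) * R' := by
    rw [mul_assoc, h'.proj_mul]
  rw [h3, h4, h5, ← sub_mul, ← mul_sub, sub_sub_sub_cancel_left, ← sub_smul, mul_smul_comm, mul_one,
    smul_mul_assoc, Complex.ofReal_sub]

/-- Since R vanishes on ker Q, z enters only through −z‖x‖² and through R, which makes monotonicity
in z visible. -/
theorem IsCompressionInverse.re_schur_apply {B Q R : X →L[ℂ] X} {z : ℝ} (hB : IsSelfAdjoint B)
    (h : IsCompressionInverse (B - (z : ℂ) • (1 : X →L[ℂ] X)) Q R) {x : X} (hx : Q x = 0) :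
    (opForm (schur (B - (z : ℂ) • (1 : X →L[ℂ] X)) R) x x).re =
      (inner ℂ (B x) x).re - z * ‖x‖ ^ 2 - (inner ℂ (R (B x)) (B x)).re := by
  have hR := h.inv_apply_eq_zero hx
  have h1 : inner ℂ (R (B x)) x = (0 : ℂ) := by
    rw [inner_apply_comm_of_isSelfAdjoint h.isSelfAdjoint_inv, hR, inner_zero_right]
  have h2 : schur (B - (z : ℂ) • (1 : X →L[ℂ] X)) R x =
      B x - (z : ℂ) • x - (B (R (B x)) - (z : ℂ) • R (B x)) := by
    simp [schur, hR]
  rw [opForm_apply, h2, inner_sub_left, inner_sub_left, inner_sub_left, inner_smul_left,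
    inner_smul_left, h1, inner_apply_comm_of_isSelfAdjoint hB (R (B x))]
  simp [re_inner_self, -inner_self_eq_norm_sq_to_K]

theorem eventually_lt_iff_of_finset (Z : Finset ℝ) (z₀ : ℝ) :
    ∀ᶠ z in 𝓝 z₀, ∀ r ∈ Z, r ≠ z₀ → (r < z ↔ r < z₀) := by
  rw [Finset.eventually_all]
  intro r _
  rcases lt_trichotomy r z₀ with h | h | h
  · filter_upwards [lt_mem_nhds h] with z hz _
    exact ⟨fun _ => h, fun _ => hz⟩
  · exact Eventually.of_forall fun z hr => absurd h hr
  · filter_upwards [gt_mem_nhds h] with z hz _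
    exact ⟨fun h' => absurd hz h'.not_gt, fun h' => absurd h h'.not_gt⟩

/-- The negative index of the Schur complement of `B - z` increases from `z = 0` to `z = e` by the
number of eigenvalues of `B` in `[0, e]`. -/
theorem negIdx_schur_eq_add_nonnegCount {B Q : X →L[ℂ] X} {R : ℝ → X →L[ℂ] X} {e : ℝ}
    (hB : IsSelfAdjoint B) (hadm : IsAdmissibleLevel B e) {F : Submodule ℂ X}
    [FiniteDimensional ℂ F] (hF : ∀ x, x ∈ F ↔ Q x = 0) (hRc : ContinuousOn R (Set.Icc 0 e))
    (hR : ∀ z ∈ Set.Icc 0 e, IsCompressionInverse (B - (z : ℂ) • (1 : X →L[ℂ] X)) Q (R z)) :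
    negIdx (opForm (schur (B - (e : ℂ) • (1 : X →L[ℂ] X)) (R e))) F =
      negIdx (opForm (schur (B - ((0 : ℝ) : ℂ) • (1 : X →L[ℂ] X)) (R 0))) F + nonnegCount B e := by
  have he : 0 ≤ e := hadm.1.le
  set S : ℝ → X →L[ℂ] X := fun z => schur (B - (z : ℂ) • (1 : X →L[ℂ] X)) (R z) with hS
  set d : ℝ → ℕ := fun r => Module.finrank ℂ (Module.End.eigenspace (B : X →ₗ[ℂ] X) (r : ℂ))
    with hd
  have hfin : {r : ℝ | r ∈ Set.Icc 0 e ∧ (r : ℂ) ∈ spectrum ℂ B}.Finite :=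
    hadm.2.2.2.1.subset fun r hr => ⟨⟨by linarith [hr.1.1, hadm.1], hr.1.2⟩, hr.2⟩
  set Z := hfin.toFinset with hZdef
  have hZ : ∀ r, r ∈ Z ↔ r ∈ Set.Icc 0 e ∧ (r : ℂ) ∈ spectrum ℂ B := fun r => by
    rw [hZdef, Set.Finite.mem_toFinset]; rfl
  -- The index minus the number of eigenvalues in [0, z). The strict inequality matches the index,
  -- which jumps only to the right of an eigenvalue. The function g is locally constant, hence
  -- constant on [0, e].
  set g : ℝ → ℤ := fun z => (negIdx (opForm (S z)) F : ℤ) - ∑ r ∈ Z, if r < z then (d r : ℤ) else 0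
    with hg
  have hSc : ContinuousOn S (Set.Icc 0 e) := by
    have h1 : ContinuousOn (fun z : ℝ => B - (z : ℂ) • (1 : X →L[ℂ] X)) (Set.Icc 0 e) :=
      Continuous.continuousOn (by fun_prop)
    exact h1.sub ((h1.mul hRc).mul h1)
  have hloc : ∀ z₀ ∈ Set.Icc 0 e, ∀ᶠ z in 𝓝[Set.Icc 0 e] z₀, g z = g z₀ := by
    intro z₀ hz₀
    have hrad : Module.finrank ℂ (rad (opForm (S z₀)) F) = d z₀ := by
      rw [hS, (hR z₀ hz₀).finrank_rad_schur hF, ker_sub_smul_one]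
    have hmono : ∀ᶠ z in 𝓝[Set.Icc 0 e] z₀, ∀ x ∈ F, x ≠ 0 → ∃ q > 0,
        (opForm (S z₀) x x).re - (opForm (S z) x x).re = (z - z₀) * q := by
      have hsmall : ∀ᶠ z in 𝓝[Set.Icc 0 e] z₀, ‖R z - R z₀‖ * ‖R z₀‖ * ‖B‖ ^ 2 < 1 := by
        have h1 : Tendsto (fun z => ‖R z - R z₀‖ * ‖R z₀‖ * ‖B‖ ^ 2) (𝓝[Set.Icc 0 e] z₀)
            (𝓝 (‖R z₀ - R z₀‖ * ‖R z₀‖ * ‖B‖ ^ 2)) :=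
          (((hRc z₀ hz₀).sub tendsto_const_nhds).norm.mul_const _).mul_const _
        refine h1.eventually (gt_mem_nhds ?_)
        simp
      filter_upwards [hsmall, self_mem_nhdsWithin] with z hz hzI x hx hx0
      have hQ := (hF x).1 hx
      -- The difference quotient from the resolvent identity. Near z₀ the second term is ‖R(z₀)Bx‖²
      -- up to an error below ‖x‖², so the sum is positive.
      refine ⟨‖x‖ ^ 2 + (inner ℂ ((R z₀ * R z) (B x)) (B x)).re, ?_, ?_⟩
      · have h1 : (inner ℂ ((R z₀ * R z) (B x)) (B x)).re =
            ‖R z₀ (B x)‖ ^ 2 + (inner ℂ ((R z - R z₀) (B x)) (R z₀ (B x))).re := by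
          rw [mul_apply_eq_comp, inner_apply_comm_of_isSelfAdjoint (hR z₀ hz₀).isSelfAdjoint_inv,
            sub_apply, inner_sub_left, Complex.sub_re, re_inner_self]
          ring
        have h2 := neg_le_of_abs_le (abs_re_inner_le ((R z - R z₀) (B x)) (R z₀ (B x)))
        have h3 : ‖(R z - R z₀) (B x)‖ * ‖R z₀ (B x)‖ ≤
            ‖R z - R z₀‖ * ‖R z₀‖ * ‖B‖ ^ 2 * ‖x‖ ^ 2 := by
          have a1 := (R z - R z₀).le_opNorm_of_le (B.le_opNorm x)
          have a2 := (R z₀).le_opNorm_of_le (B.le_opNorm x)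
          calc _ ≤ (‖R z - R z₀‖ * (‖B‖ * ‖x‖)) * (‖R z₀‖ * (‖B‖ * ‖x‖)) := by gcongr
            _ = _ := by ring
        have h4 : 0 < ‖x‖ ^ 2 := by positivity
        have h5 := mul_lt_mul_of_pos_right hz h4
        have h6 := sq_nonneg ‖R z₀ (B x)‖
        rw [h1]
        linarith
      · have h1 := (hR z₀ hz₀).resolvent_identity (hR z hzI)
        have h2 : (inner ℂ (R z₀ (B x)) (B x)).re - (inner ℂ (R z (B x)) (B x)).re =
            (z₀ - z) * (inner ℂ ((R z₀ * R z) (B x)) (B x)).re := by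
          rw [← Complex.sub_re, ← inner_sub_left, ← sub_apply, h1, smul_apply, inner_smul_left,
            Complex.conj_ofReal, Complex.re_ofReal_mul]
        rw [hS, (hR z₀ hz₀).re_schur_apply hB hQ, (hR z hzI).re_schur_apply hB hQ]
        linarith
    have hj := eventually_negIdx_jump (S := S) (hSc z₀ hz₀)
      (by filter_upwards [self_mem_nhdsWithin] with z hz using (hR z hz).isSelfAdjoint_schur)
      (hR z₀ hz₀).isSelfAdjoint_schur F hmono
    filter_upwards [hj, nhdsWithin_le_nhds (eventually_lt_iff_of_finset Z z₀)] with z h1 h2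
    have h3 : ∑ r ∈ Z, (if r < z then (d r : ℤ) else 0) =
        ∑ r ∈ Z, ((if r < z₀ then (d r : ℤ) else 0) +
          if r = z₀ then (if z₀ < z then (d z₀ : ℤ) else 0) else 0) := by
      refine Finset.sum_congr rfl fun r hr => ?_
      by_cases hrz : r = z₀
      · subst hrz; simp
      · simp [hrz, h2 r hr hrz]
    have h4 : z₀ ∉ Z → d z₀ = 0 := by
      intro h
      have : (z₀ : ℂ) ∉ spectrum ℂ B := fun h' => h ((hZ z₀).2 ⟨hz₀, h'⟩)
      simp only [hd]
      rw [eigenspace_eq_bot this, finrank_bot]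
    simp only [hg]
    rw [h1, h3, Finset.sum_add_distrib, Finset.sum_ite_eq', hrad]
    by_cases hzZ : z₀ ∈ Z
    · rw [if_pos hzZ]
      push_cast
      ring
    · simp [hzZ, h4 hzZ]
  have hgc : ContinuousOn g (Set.Icc 0 e) := fun z₀ hz₀ =>
    tendsto_nhds_of_eventually_eq (hloc z₀ hz₀)
  have hge := isPreconnected_Icc.constant hgc (Set.right_mem_Icc.2 he) (Set.left_mem_Icc.2 he)
  have hs0 : ∑ r ∈ Z, (if r < 0 then (d r : ℤ) else 0) = 0 :=
    Finset.sum_eq_zero fun r hr => if_neg ((hZ r).1 hr).1.1.not_gt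
  have hse : ∑ r ∈ Z, (if r < e then (d r : ℤ) else 0) = ∑ r ∈ Z, (d r : ℤ) := by
    refine Finset.sum_congr rfl fun r hr => if_pos (lt_of_le_of_ne ((hZ r).1 hr).1.2 ?_)
    rintro rfl
    exact hadm.2.1 ((hZ r).1 hr).2
  rw [nonnegCount_eq_sum hadm hZ]
  simp only [hg, hs0, hse] at hge
  have : ((negIdx (opForm (S e)) F : ℕ) : ℤ) =
      ((negIdx (opForm (S 0)) F + ∑ r ∈ Z, d r : ℕ) : ℤ) := by
    push_cast
    linarith
  exact Int.ofNat_inj.1 this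

end Jump

/-! ### A common invertible compression. -/

section Construction

variable {X : Type*} [NormedAddCommGroup X] [InnerProductSpace ℂ X] [CompleteSpace X]

/-- If `A₀ - z` is Fredholm for `z ∈ [0, e]`, there is a subspace of finite codimension of the range
of `P` on which the compression of `A₀ - z` is invertible for all `z ∈ [0, e]`. -/
theorem exists_isCompressionInverse {A₀ P : X →L[ℂ] X} (hA₀ : IsSelfAdjoint A₀)
    (hP : IsStarProjection P) (hker : FiniteDimensional ℂ (LinearMap.ker (P : X →ₗ[ℂ] X)))
    (hAP : A₀ * P = A₀) {e : ℝ}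
    (hfr : ∀ z ∈ Set.Icc 0 e, (A₀ - (z : ℂ) • (1 : X →L[ℂ] X)).IsFredholm) :
    ∃ (F : Submodule ℂ X) (Q : X →L[ℂ] X) (R : ℝ → X →L[ℂ] X), FiniteDimensional ℂ F ∧
      (∀ x, x ∈ F ↔ Q x = 0) ∧ P * Q = Q ∧ ContinuousOn R (Set.Icc 0 e) ∧
      ∀ B : X →L[ℂ] X, IsSelfAdjoint B → P * B * P = A₀ → ∀ z ∈ Set.Icc 0 e,
        IsCompressionInverse (B - (z : ℂ) • (1 : X →L[ℂ] X)) Q (R z) := by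
  have hfin := finite_spectrum_of_isFredholm hA₀ hfr
  have hZ : ∀ r, r ∈ hfin.toFinset ↔ r ∈ Set.Icc 0 e ∧ (r : ℂ) ∈ spectrum ℂ A₀ := fun r => by
    rw [Set.Finite.mem_toFinset]; rfl
  set E := ⨆ r ∈ Set.Icc 0 e, Module.End.eigenspace (A₀ : X →ₗ[ℂ] X) (r : ℂ) with hE
  have hEfin : FiniteDimensional ℂ E := by
    rw [hE, biSup_eigenspace_eq hZ]
    refine (finrank_biSup_of_iSupIndep (iSupIndep_eigenspace_ofReal A₀) _ fun r hr => ?_).1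
    rw [← ker_sub_smul_one]
    exact (hfr r ((hZ r).1 hr).1).finite_ker
  have hEr : ∀ r ∈ Set.Icc 0 e, Module.End.eigenspace (A₀ : X →ₗ[ℂ] X) (r : ℂ) ≤ E := fun r hr =>
    le_iSup₂_of_le (f := fun (r : ℝ) (_ : r ∈ Set.Icc 0 e) =>
      Module.End.eigenspace (A₀ : X →ₗ[ℂ] X) (r : ℂ)) r hr le_rfl
  -- E absorbs the kernels of A₀ − z for z in [0, e]; ker P is added so that F^⊥ lies in the range
  -- of P. Both are A₀-invariant, so Q will commute with A₀.
  set F := E ⊔ LinearMap.ker (P : X →ₗ[ℂ] X) with hFdef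
  have hFfin : FiniteDimensional ℂ F := inferInstance
  set T : X →L[ℂ] X := F.starProjection with hT
  have hTs : IsSelfAdjoint T := isSelfAdjoint_starProjection F
  have hTT : T * T = T := F.isIdempotentElem_starProjection
  have hTF : ∀ x, x ∈ F → T x = x := fun x hx => Submodule.starProjection_eq_self_iff.2 hx
  have hTmem : ∀ x, T x ∈ F := fun x => F.starProjection_apply_mem x
  have hinv : F ≤ F.comap (A₀ : X →ₗ[ℂ] X) := by
    refine sup_le (iSup₂_le fun r hr x hx => ?_) fun x hx => ?_
    · have h1 : A₀ x = (r : ℂ) • x := Module.End.mem_eigenspace_iff.1 hx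
      rw [Submodule.mem_comap, ContinuousLinearMap.coe_coe, h1]
      exact F.smul_mem _ (le_sup_left (a := E) (hEr r hr hx))
    · have hx' : P x = 0 := hx
      have : A₀ x = 0 := by rw [← hAP, mul_apply_eq_comp, hx', map_zero]
      rw [Submodule.mem_comap, ContinuousLinearMap.coe_coe, this]
      exact F.zero_mem
  have hTAT : T * A₀ * T = A₀ * T := by
    ext x
    exact hTF _ (hinv (hTmem x))
  have hcomm : T * A₀ = A₀ * T := by
    have := congrArg star hTAT
    rw [star_mul, star_mul, star_mul, hTs.star_eq, hA₀.star_eq, ← mul_assoc, hTAT] at this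
    exact this.symm
  have hPT : P * (1 - T) = 1 - T := by
    have h1 : T * (1 - P) = 1 - P := by
      ext x
      refine hTF _ (le_sup_right (a := E) (?_ : P ((1 - P) x) = 0))
      rw [← mul_apply_eq_comp, mul_sub, hP.isIdempotentElem.eq, mul_one, sub_self]
      rfl
    have h2 := congrArg star h1
    rw [star_mul, star_sub, star_one, hP.isSelfAdjoint.star_eq, hTs.star_eq] at h2
    rw [sub_mul, one_mul, sub_eq_iff_eq_add] at h2
    have h3 : P * T = T - (1 - P) := by rw [eq_sub_iff_add_eq, add_comm]; exact h2.symm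
    rw [mul_sub, mul_one, h3]
    abel
  set Q : X →L[ℂ] X := 1 - T with hQ
  have hQs : IsSelfAdjoint Q := (IsSelfAdjoint.one _).sub hTs
  have hQQ : Q * Q = Q := by
    rw [hQ]
    exact (F.isIdempotentElem_starProjection).one_sub
  have hQA : Q * A₀ = A₀ * Q := by rw [hQ, sub_mul, mul_sub, hcomm, one_mul, mul_one]
  have hQP : Q * P = Q := by
    have := congrArg star hPT
    rwa [star_mul, hQs.star_eq, hP.isSelfAdjoint.star_eq] at this
  have hQF : ∀ x, x ∈ F ↔ Q x = 0 := fun x => by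
    have h1 : Q x = x - T x := rfl
    rw [h1, sub_eq_zero]
    exact ⟨fun hx => (hTF x hx).symm, fun hx => hx ▸ hTmem x⟩
  clear_value Q
  set C : ℝ → X →L[ℂ] X := fun z => A₀ - (z : ℂ) • (1 : X →L[ℂ] X) with hC
  set L : ℝ → X →L[ℂ] X := fun z => C z * Q + (1 - Q) with hL
  have hQC : ∀ z, Q * C z = C z * Q := fun z => by
    simp only [hC, mul_sub, sub_mul, hQA, mul_smul_comm, smul_mul_assoc, mul_one, one_mul]
  have hLs : ∀ z, IsSelfAdjoint (L z) := fun z => by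
    refine IsSelfAdjoint.add ?_ ((IsSelfAdjoint.one _).sub hQs)
    rw [IsSelfAdjoint, star_mul, hQs.star_eq, (isSelfAdjoint_sub_smul_one hA₀ z).star_eq]
    exact hQC z
  have hQL : ∀ z, Q * L z = C z * Q := fun z => by
    simp only [hL]
    rw [mul_add, mul_sub, hQQ, mul_one, sub_self, add_zero, ← mul_assoc, hQC, mul_assoc, hQQ]
  have hLQ : ∀ z, L z * Q = C z * Q := fun z => by
    have h1 : L z = C z * Q + (1 - Q) := rfl
    rw [h1, add_mul, sub_mul 1 Q, hQQ, one_mul, sub_self, add_zero, mul_assoc, hQQ]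
  have hLu : ∀ z ∈ Set.Icc 0 e, IsUnit (L z) := by
    intro z hz
    refine isUnit_of_isFredholm_of_injective (hLs z) (isFredholm_of_sub (hfr z hz) ?_)
      fun x hx => ?_
    · have hTf : IsFinRank T := IsFinRank.of_forall_mem (F := F) hTmem
      have : L z - C z = (1 - C z) * T := by
        simp only [hL, hQ]; noncomm_ring
      rw [show A₀ - (z : ℂ) • (1 : X →L[ℂ] X) = C z from rfl, this]
      exact hTf.mul_left _
    · have h1 : C z (Q x) = 0 := by
        have : (Q * L z) x = 0 := by rw [mul_apply_eq_comp, hx, map_zero]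
        rwa [hQL] at this
      have h2 : Q x = x := by
        have : C z (Q x) + (x - Q x) = 0 := hx
        rw [h1, zero_add, sub_eq_zero] at this
        exact this.symm
      have h3 : Q x ∈ F := by
        refine le_sup_left (a := E) (hEr z hz ?_)
        rw [← ker_sub_smul_one]
        exact h1
      rw [← h2, ← hQQ, mul_apply_eq_comp]
      exact (hQF _).1 h3
  have hcommQ : ∀ z ∈ Set.Icc 0 e, Ring.inverse (L z) * Q = Q * Ring.inverse (L z) := by
    intro z hz
    obtain ⟨u, hu⟩ := hLu z hz
    rw [← hu, Ring.inverse_unit]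
    have : Commute (u : X →L[ℂ] X) Q := by
      rw [hu]; exact (hLQ z).trans (hQL z).symm
    exact this.units_inv_left
  refine ⟨F, Q, fun z => Ring.inverse (L z) * Q, hFfin, hQF, hPT, fun z hz => ?_,
    fun B hB hPB z hz => ⟨isSelfAdjoint_sub_smul_one hB z, hQs, ?_, ?_, ?_⟩⟩
  · have hLc : Continuous L := by
      simp only [hL, hC]; fun_prop
    obtain ⟨u, hu⟩ := hLu z hz
    have h1 : ContinuousAt Ring.inverse (L z) := hu ▸ NormedRing.inverse_continuousAt u
    exact ((ContinuousAt.comp (f := L) h1 hLc.continuousAt).mul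
      continuousAt_const).continuousWithinAt
  · beta_reduce
    rw [IsSelfAdjoint, star_mul, hQs.star_eq, ← Ring.inverse_star, (hLs z).star_eq, hcommQ z hz]
  · beta_reduce
    rw [hcommQ z hz, ← mul_assoc, hQQ]
  -- Because Q = QP = PQ, the compression sees B only through PBP = A₀; hence R is independent of B.
  · have h1 : Q * B * Q = A₀ * Q := by
      calc Q * B * Q = (Q * P) * B * (P * Q) := by rw [hQP, hPT]
        _ = Q * (P * B * P) * Q := by noncomm_ring
        _ = A₀ * Q := by rw [hPB, hQA, mul_assoc, hQQ]
    have h2 : Q * (B - (z : ℂ) • (1 : X →L[ℂ] X)) * Q = Q * L z := by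
      rw [hQL]
      simp only [hC, mul_sub, sub_mul, h1, mul_smul_comm, smul_mul_assoc, mul_one, one_mul, hQQ]
    beta_reduce
    rw [hcommQ z hz, ← mul_assoc, h2, mul_assoc, Ring.mul_inverse_cancel _ (hLu z hz), mul_one]

end Construction

/-! ### The relative index and its variation along the curve. -/

section RelativeIndex

variable {X : Type*} [NormedAddCommGroup X] [InnerProductSpace ℂ X]

/-- The index of the form of `B` relative to a subspace `M`, computed on the orthogonal complement
of `M` with respect to the form. -/
noncomputable def relIdx (B : X →L[ℂ] X) (M : Submodule ℂ X) : ℤ :=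
  (negIdx (opForm B) (formCompl (opForm B) M) : ℤ)
    + (Module.finrank ℂ (rad (opForm B) (formCompl (opForm B) M)) : ℤ)
    - (Module.finrank ℂ (formKer (opForm B)) : ℤ)

theorem mem_formKer_opForm {B : X →L[ℂ] X} {x : X} : x ∈ formKer (opForm B) ↔ B x = 0 := by
  refine ⟨fun h => inner_self_eq_zero.1 (h (B x) trivial), fun h y _ => ?_⟩
  rw [opForm_apply, h, inner_zero_left]

variable [CompleteSpace X]

theorem mem_formCompl_range {B P : X →L[ℂ] X} (hP : IsSelfAdjoint P) {x : X} :
    x ∈ formCompl (opForm B) (LinearMap.range (P : X →ₗ[ℂ] X)) ↔ P (B x) = 0 := by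
  constructor
  · intro h
    have h1 := h (P (P (B x))) ⟨P (B x), rfl⟩
    rw [opForm_apply, ← inner_apply_comm_of_isSelfAdjoint hP] at h1
    exact inner_self_eq_zero.1 h1
  · rintro h _ ⟨y, rfl⟩
    rw [opForm_apply, ContinuousLinearMap.coe_coe, ← inner_apply_comm_of_isSelfAdjoint hP, h,
      inner_zero_left]

/-- The negative index of the Schur complement of `B` is, up to a constant that only depends on the
compression `P B P`, the index of `B` relative to the range of `P`. -/
theorem negIdx_schur_eq_add_relIdx {A₀ P Q R : X →L[ℂ] X} (hP : IsStarProjection P)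
    (hPQ : P * Q = Q) {F : Submodule ℂ X} [FiniteDimensional ℂ F] (hF : ∀ x, x ∈ F ↔ Q x = 0)
    {M M' : Submodule ℂ X} (hM : M = LinearMap.range (P : X →ₗ[ℂ] X))
    (hM' : ∀ x, x ∈ M' ↔ x ∈ M ∧ Q (A₀ x) = 0)
    {B : X →L[ℂ] X} (hPB : P * B * P = A₀) (h : IsCompressionInverse B Q R) :
    (negIdx (opForm (schur B R)) F : ℤ) = negIdx (opForm A₀) M' + relIdx B M := by
  have hJ := isHermForm_opForm h.isSelfAdjoint
  have hQP : Q * P = Q := by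
    have := congrArg star hPQ
    rwa [star_mul, h.isSelfAdjoint_proj.star_eq, hP.isSelfAdjoint.star_eq] at this
  have hPx : ∀ x ∈ M, P x = x := by
    rw [hM]
    rintro _ ⟨y, rfl⟩
    exact congrArg (fun T : X →L[ℂ] X => T y) hP.isIdempotentElem.eq
  set Y : Submodule ℂ X := LinearMap.ker ((Q * B : X →L[ℂ] X) : X →ₗ[ℂ] X) with hYdef
  have hY : ∀ x, x ∈ Y ↔ Q (B x) = 0 := fun x => Iff.rfl
  obtain ⟨hYfin, hidx⟩ := h.negIdx_schur hF hY
  have hM'Y : ∀ x, x ∈ M' ↔ x ∈ M ∧ x ∈ Y := by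
    intro x
    rw [hM', hY]
    refine and_congr_right fun hx => ?_
    have : Q (A₀ x) = Q (B x) := by
      calc Q (A₀ x) = (Q * P) (B (P x)) := by rw [← hPB]; rfl
        _ = Q (B x) := by rw [hQP, hPx x hx]
    rw [this]
  have hM'le : M' ≤ Y := fun x hx => ((hM'Y x).1 hx).2
  have hM'fin : FiniteDimensional ℂ M' := Submodule.finiteDimensional_of_le hM'le
  -- The vectors of M' are fixed by P and PBP = A₀, so this term is the same for every B.
  have hform : negIdx (opForm B) M' = negIdx (opForm A₀) M' := by
    refine negIdx_congr fun x hx => ?_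
    have hx' := hPx x ((hM'Y x).1 hx).1
    rw [opForm_apply, opForm_apply, ← hPB]
    have : (P * B * P) x = P (B x) := by
      rw [mul_apply_eq_comp, hx', mul_apply_eq_comp]
    rw [this, inner_apply_comm_of_isSelfAdjoint hP.isSelfAdjoint, hx']
  have hsplit : ∀ y, y - R (B y) ∈ Y := fun y => by
    have := congrArg (fun T : X →L[ℂ] X => T y) h.proj_mul_schur
    rw [hY]
    simpa [schur] using this
  have horth : ∀ x ∈ Y, ∀ y, opForm B x (R y) = 0 := fun x hx y => by
    rw [opForm_apply, ← inner_apply_comm_of_isSelfAdjoint h.isSelfAdjoint_inv,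
      h.inv_apply_eq_zero ((hY x).1 hx),
      inner_zero_left]
  have hRM : ∀ y, R y ∈ M := fun y => by
    rw [hM]
    refine ⟨R y, ?_⟩
    have : P * R = R := by rw [← h.proj_mul, ← mul_assoc, hPQ]
    exact congrArg (fun T : X →L[ℂ] X => T y) this
  -- Each y in M is the sum of y − RBy in M' and RBy, and the latter is B-orthogonal to Y.
  have hN : Y ⊓ formCompl (opForm B) M' = formCompl (opForm B) M := by
    ext x
    constructor
    · rintro ⟨hx, hx'⟩ y hy
      have h1 := hx' (y - R (B y)) ((hM'Y _).2 ⟨M.sub_mem hy (hRM _), hsplit y⟩)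
      rwa [map_sub, horth x hx, sub_zero] at h1
    · intro hx
      refine ⟨?_, fun y hy => hx y ((hM'Y y).1 hy).1⟩
      have hx' : P (B x) = 0 := by
        rw [hM] at hx
        exact (mem_formCompl_range hP.isSelfAdjoint).1 hx
      refine (hY x).2 ?_
      rw [← hQP, mul_apply_eq_comp, hx', map_zero]
  have hrad : rad (opForm B) Y = formKer (opForm B) := by
    ext x
    constructor
    · rintro ⟨hx, hx'⟩ y -
      have h1 := hx' _ (hsplit y)
      rwa [map_sub, horth x hx, sub_zero] at h1
    · intro hx
      have hx' := mem_formKer_opForm.1 hx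
      exact ⟨(hY x).2 (by rw [hx', map_zero]), fun y _ => hx y trivial⟩
  have key := negIdx_add_finrank_rad hJ hM'le
  rw [hN, hrad, hform] at key
  rw [hidx, relIdx]
  omega

/-- The range of A₀ lies in M, so the complement of M is ker A₀, where the form vanishes; the two
nullities cancel. -/
theorem relIdx_compression {A₀ P : X →L[ℂ] X} (hP : IsStarProjection P) (hPA : P * A₀ = A₀)
    {M : Submodule ℂ X} (hM : M = LinearMap.range (P : X →ₗ[ℂ] X))
    (hfin : FiniteDimensional ℂ (LinearMap.ker (A₀ : X →ₗ[ℂ] X))) : relIdx A₀ M = 0 := by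
  have hN : formCompl (opForm A₀) M = formKer (opForm A₀) := by
    ext x
    rw [hM, mem_formCompl_range hP.isSelfAdjoint, ← mul_apply_eq_comp, hPA, mem_formKer_opForm]
  have hk : formKer (opForm A₀) = LinearMap.ker (A₀ : X →ₗ[ℂ] X) := by
    ext x; exact mem_formKer_opForm
  have hkfin : FiniteDimensional ℂ (formKer (opForm A₀)) := by rwa [hk]
  have hrad : rad (opForm A₀) (formKer (opForm A₀)) = formKer (opForm A₀) :=
    inf_eq_left.2 fun x hx y _ => hx y trivial
  have hneg : negIdx (opForm A₀) (formKer (opForm A₀)) = 0 := by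
    have := NonnegOn.negIdx_add_le (J := opForm A₀) (C := formKer (opForm A₀))
      (fun x hx => by rw [hx x trivial]; simp) le_rfl
    omega
  rw [relIdx, hN, hrad, hneg]
  simp

/-- On an interval with a common admissible level, the number of nonnegative eigenvalues below the
level and the relative index change by opposite amounts. -/
theorem nonnegCount_sub_nonnegCount {A₀ P : X →L[ℂ] X} (hP : IsStarProjection P)
    (hker : FiniteDimensional ℂ (LinearMap.ker (P : X →ₗ[ℂ] X))) {M : Submodule ℂ X}
    (hM : M = LinearMap.range (P : X →ₗ[ℂ] X)) {B : ℝ → X →L[ℂ] X}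
    (hB : ∀ s, IsSelfAdjoint (B s)) (hc : Continuous B) (hPB : ∀ s, P * B s * P = A₀)
    (hfr : ∀ s, IsFinRank (A₀ - B s)) {a b e : ℝ} (hab : a ≤ b)
    (hadm : ∀ s ∈ Set.Icc a b, IsAdmissibleLevel (B s) e) :
    (nonnegCount (B b) e : ℤ) - nonnegCount (B a) e = relIdx (B a) M - relIdx (B b) M := by
  have ha : a ∈ Set.Icc a b := Set.left_mem_Icc.2 hab
  have hb : b ∈ Set.Icc a b := Set.right_mem_Icc.2 hab
  have hA₀ : IsSelfAdjoint A₀ := by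
    rw [← hPB a, IsSelfAdjoint, star_mul, star_mul, hP.isSelfAdjoint.star_eq, (hB a).star_eq,
      mul_assoc]
  have hAP : A₀ * P = A₀ := by
    rw [← hPB a, mul_assoc, hP.isIdempotentElem.eq]
  have he : 0 < e := (hadm a ha).1
  have h0 : (0 : ℝ) ∈ Set.Icc 0 e := Set.left_mem_Icc.2 he.le
  have h1 : e ∈ Set.Icc 0 e := Set.right_mem_Icc.2 he.le
  obtain ⟨F, Q, R, hFfin, hF, hPQ, hRc, hR⟩ := exists_isCompressionInverse (e := e) hA₀ hP hker hAP
    fun z hz => isFredholm_of_sub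
      (((isAdmissibleLevel_iff (hB a)).1 (hadm a ha)).2.2.2 z ⟨by linarith [hz.1], hz.2⟩) (by
        rw [sub_sub_sub_cancel_right]; exact hfr a)
  set S : ℝ → X →L[ℂ] X := fun s => schur (B s - (e : ℂ) • (1 : X →L[ℂ] X)) (R e) with hS
  have hSc : Continuous S := by
    have h2 : Continuous fun s => B s - (e : ℂ) • (1 : X →L[ℂ] X) := hc.sub continuous_const
    exact h2.sub ((h2.mul continuous_const).mul h2)
  -- As e is never in the spectrum, the Schur complement at z = e stays nondegenerate on F and its
  -- index is locally constant in s.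
  have hconst : ContinuousOn (fun s => negIdx (opForm (S s)) F) (Set.Icc a b) := by
    intro s hs
    have hCs := hR (B s) (hB s) (hPB s) e h1
    refine tendsto_nhds_of_eventually_eq (eventually_negIdx_eq
      (hSc.tendsto s |>.mono_left nhdsWithin_le_nhds) (Eventually.of_forall fun s' =>
        (hR (B s') (hB s') (hPB s') e h1).isSelfAdjoint_schur) hCs.isSelfAdjoint_schur F ?_)
    rw [hCs.finrank_rad_schur hF, ker_sub_smul_one, eigenspace_eq_bot (hadm s hs).2.1, finrank_bot]
  have heq : negIdx (opForm (S b)) F = negIdx (opForm (S a)) F :=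
    isPreconnected_Icc.constant hconst hb ha
  set M' : Submodule ℂ X := M ⊓ LinearMap.ker ((Q * A₀ : X →L[ℂ] X) : X →ₗ[ℂ] X) with hM'
  have hidx : ∀ s ∈ Set.Icc a b, (negIdx (opForm (S s)) F : ℤ) =
      negIdx (opForm A₀) M' + relIdx (B s) M + nonnegCount (B s) e := by
    intro s hs
    have h2 := negIdx_schur_eq_add_nonnegCount (hB s) (hadm s hs) hF hRc (hR (B s) (hB s) (hPB s))
    have h3 := hR (B s) (hB s) (hPB s) 0 h0
    rw [Complex.ofReal_zero, zero_smul, sub_zero] at h2 h3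
    have h4 := negIdx_schur_eq_add_relIdx hP hPQ hF hM (M' := M') (fun x => Iff.rfl) (hPB s) h3
    rw [← h4]
    exact_mod_cast h2
  have := hidx a ha
  have := hidx b hb
  rw [heq] at this
  linarith

end RelativeIndex

/-! ### Existence of subdivisions with admissible levels. -/

section SpectralFlow

variable {X : Type*} [NormedAddCommGroup X] [InnerProductSpace ℂ X]

theorem exists_isFlowSubdivision {B : ℝ → X →L[ℂ] X}
    (h : ∀ s, ∃ e, ∀ᶠ s' in 𝓝 s, IsAdmissibleLevel (B s') e) :
    ∃ n t e, IsFlowSubdivision B n t e := by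
  choose e he using h
  obtain ⟨t, ht0, htm, ⟨n, hn⟩, hsub⟩ := exists_monotone_Icc_subset_open_cover_unitInterval
    (c := fun i : unitInterval =>
      Subtype.val ⁻¹' interior {s : ℝ | IsAdmissibleLevel (B s) (e i)})
    (fun i => isOpen_interior.preimage continuous_subtype_val)
    (fun i _ => Set.mem_iUnion.2 ⟨i, mem_interior_iff_mem_nhds.2 (he i)⟩)
  choose i hi using hsub
  refine ⟨n, fun j => t j, fun j => e (i j), ?_, ?_, fun j _ => htm j.le_succ,
    fun j _ s hs => ?_⟩
  · simp [ht0]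
  · simp [hn n le_rfl]
  · have hs01 : s ∈ unitInterval := ⟨(t j).2.1.trans hs.1, hs.2.trans (t (j + 1)).2.2⟩
    have h1 : (⟨s, hs01⟩ : unitInterval) ∈ Set.Icc (t j) (t (j + 1)) := hs
    have h2 : s ∈ interior {s : ℝ | IsAdmissibleLevel (B s) (e (i j))} := hi j h1
    have h3 : s ∈ {s : ℝ | IsAdmissibleLevel (B s) (e (i j))} := interior_subset h2
    exact h3

variable [CompleteSpace X]

/-- Near each parameter, a continuous family of finite rank perturbations of a selfadjoint Fredholm
operator has a common admissible level. -/
theorem exists_eventually_isAdmissibleLevel {B : ℝ → X →L[ℂ] X} (hB : ∀ s, IsSelfAdjoint (B s))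
    (hc : Continuous B) (hF : ∀ s, (B s).IsFredholm) (hfr : ∀ s s', IsFinRank (B s - B s'))
    (s₀ : ℝ) : ∃ e, ∀ᶠ s in 𝓝 s₀, IsAdmissibleLevel (B s) e := by
  have h0 := eventually_notMem_spectrum (B := B s₀) (r₀ := 0) (hB s₀) (by simpa using hF s₀)
  rw [eventually_nhdsWithin_iff, Metric.eventually_nhds_iff] at h0
  obtain ⟨δ, hδ, hball⟩ := h0
  have hns : ∀ r : ℝ, r ≠ 0 → |r| ≤ δ / 2 → (r : ℂ) ∉ spectrum ℂ (B s₀) := fun r hr hr' =>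
    hball (by rw [Real.dist_eq, sub_zero]; linarith) hr
  have hunit : ∀ r : ℝ, r ≠ 0 → |r| ≤ δ / 2 → ∀ᶠ s in 𝓝 s₀, (r : ℂ) ∉ spectrum ℂ (B s) := by
    intro r hr hr'
    have hcont : Continuous fun s => B s - (r : ℂ) • (1 : X →L[ℂ] X) := hc.sub continuous_const
    filter_upwards [(hcont.tendsto s₀).eventually
      (Units.isOpen.mem_nhds (notMem_spectrum_iff.1 (hns r hr hr')))] with s hs
    exact notMem_spectrum_iff.2 hs
  have hab : |δ / 2| ≤ δ / 2 := (abs_of_pos (half_pos hδ)).le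
  refine ⟨δ / 2, ?_⟩
  filter_upwards [hunit (δ / 2) (half_pos hδ).ne' hab,
    hunit (-(δ / 2)) (neg_ne_zero.2 (half_pos hδ).ne') (by rwa [abs_neg])] with s h1 h2
  rw [isAdmissibleLevel_iff (hB s)]
  -- Only the endpoints ±δ/2 restrict s; between them Fredholmness is inherited from `B s₀` by
  -- finite rank perturbation.
  refine ⟨half_pos hδ, h1, h2, fun r hr => ?_⟩
  refine isFredholm_of_sub (A := B s₀ - (r : ℂ) • (1 : X →L[ℂ] X)) ?_ (by
    rw [sub_sub_sub_cancel_right]; exact hfr s s₀)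
  by_cases hr0 : r = 0
  · simpa [hr0] using hF s₀
  · exact isFredholm_of_isUnit (notMem_spectrum_iff.1 (hns r hr0 (abs_le.2 hr)))

end SpectralFlow

/-! ### Comparison with the Morse index of a restricted form. -/

section MorseIndex

variable {V : Type*} [AddCommGroup V] [Module ℂ V]

/-- In particular the supremum is finite, so `toNat` in the final formula loses nothing. -/
theorem morseIndex_formRestrict (J : V →ₗ⋆[ℂ] V →ₗ[ℂ] ℂ) (N : Submodule ℂ V)
    [FiniteDimensional ℂ N] : morseIndex (formRestrict J N) = (negIdx J N : ℕ∞) := by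
  apply le_antisymm
  · refine iSup₂_le fun W hW => ?_
    rw [← Submodule.finrank_map_subtype_eq, Nat.cast_le]
    refine NegDefOn.finrank_le_negIdx (N.map_subtype_le W) ?_
    rintro _ ⟨x, hx, rfl⟩ hx0
    exact hW.2 x hx fun h => hx0 (by simp [h])
  · obtain ⟨W, hWN, hW, hn⟩ := exists_finrank_eq_negIdx J N
    rw [← hn, ← (Submodule.comapSubtypeEquivOfLe hWN).finrank_eq]
    exact le_iSup₂_of_le (W.comap N.subtype)
      ⟨inferInstance, fun x hx hx0 => hW x hx fun h => hx0 (Subtype.ext h)⟩ le_rfl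

theorem finrank_formKer_formRestrict (J : V →ₗ⋆[ℂ] V →ₗ[ℂ] ℂ) (N : Submodule ℂ V) :
    Module.finrank ℂ (formKer (formRestrict J N)) = Module.finrank ℂ (rad J N) := by
  rw [← Submodule.finrank_map_subtype_eq]
  suffices h : (formKer (formRestrict J N)).map N.subtype = rad J N by rw [h]
  ext x
  constructor
  · rintro ⟨y, hy, rfl⟩
    exact ⟨y.2, fun z hz => hy ⟨z, hz⟩ trivial⟩
  · rintro ⟨hx, hx'⟩
    exact ⟨⟨x, hx⟩, fun z _ => hx' z z.2, rfl⟩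

end MorseIndex

/-! ### The relative Morse index of a compression. -/

section Main

/-- The relative Morse index of the compression `P A P` and `A`. -/
theorem hasRelativeMorseIndex_compression {X : Type*} [NormedAddCommGroup X]
    [InnerProductSpace ℂ X] [CompleteSpace X]
    (A P : X →L[ℂ] X) (hA : IsSelfAdjoint A) (hF : A.IsFredholm)
    (hP : IsStarProjection P) (hker : FiniteDimensional ℂ (LinearMap.ker (P : X →ₗ[ℂ] X)))
    (M N : Submodule ℂ X) (hM : M = LinearMap.range (P : X →ₗ[ℂ] X))
    (hN : N = formCompl (opForm A) M) :
    FiniteDimensional ℂ N ∧ FiniteDimensional ℂ (formKer (opForm A)) ∧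
      HasRelativeMorseIndex (P ∘L A ∘L P) A
        (((morseIndex (formRestrict (opForm A) N)).toNat : ℤ)
          + (Module.finrank ℂ (formKer (formRestrict (opForm A) N)) : ℤ)
          - (Module.finrank ℂ (formKer (opForm A)) : ℤ)) := by
  have hPP := hP.isIdempotentElem.eq
  have hPs := hP.isSelfAdjoint
  have hcP : IsFinRank (1 - P) := IsFinRank.of_forall_mem (F := LinearMap.ker (P : X →ₗ[ℂ] X))
    fun x => by
      have : (P * (1 - P)) x = 0 := by rw [mul_sub, mul_one, hPP, sub_self]; rfl
      exact this
  set A₀ : X →L[ℂ] X := P ∘L A ∘L P with hA₀def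
  have hA₀ : A₀ = P * A * P := rfl
  have hPA₀ : P * A₀ = A₀ := by rw [hA₀, ← mul_assoc, ← mul_assoc, hPP]
  have hA₀P : A₀ * P = A₀ := by rw [hA₀, mul_assoc, hPP]
  have hA₀s : IsSelfAdjoint A₀ := by
    rw [hA₀, IsSelfAdjoint, star_mul, star_mul, hPs.star_eq, hA.star_eq, mul_assoc]
  have hK : IsFinRank (A - A₀) := by
    have : A - A₀ = (1 - P) * A + P * A * (1 - P) := by rw [hA₀]; noncomm_ring
    rw [this]
    exact (hcP.mul_right A).add (hcP.mul_left (P * A))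
  have hPK : P * (A - A₀) * P = 0 := by
    rw [mul_sub, sub_mul, hPA₀, hA₀P, ← hA₀, sub_self]
  set B : ℝ → X →L[ℂ] X := fun s => A₀ + (s : ℂ) • (A - A₀) with hBdef
  have hBs : ∀ s, IsSelfAdjoint (B s) := fun s =>
    hA₀s.add (IsSelfAdjoint.smul (Complex.conj_ofReal s) (hA.sub hA₀s))
  have hBc : Continuous B := by simp only [hBdef]; fun_prop
  have hPB : ∀ s, P * B s * P = A₀ := fun s => by
    simp only [hBdef]
    rw [mul_add, add_mul, mul_smul_comm, smul_mul_assoc, hPK, smul_zero, add_zero, hPA₀, hA₀P]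
  have hB0 : ∀ s, IsFinRank (A₀ - B s) := fun s => by
    have : A₀ - B s = -((s : ℂ) • (A - A₀)) := by simp only [hBdef]; abel
    rw [this]
    exact (hK.smul _).neg
  have hBB : ∀ s s', IsFinRank (B s - B s') := fun s s' => by
    have : B s - B s' = (A₀ - B s') + -(A₀ - B s) := by abel
    rw [this]
    exact (hB0 s').add (hB0 s).neg
  have hB1 : B 1 = A := by simp [hBdef]
  have hBzero : B 0 = A₀ := by simp [hBdef]
  have hBF : ∀ s, (B s).IsFredholm := fun s =>
    isFredholm_of_sub hF (by have := hBB s 1; rwa [hB1] at this)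
  have hNfin : FiniteDimensional ℂ N := by
    have hPAF : (P * A).IsFredholm := isFredholm_of_sub hF (by
      have := (hcP.mul_right A).neg
      rwa [sub_mul, one_mul, neg_sub] at this)
    have : N = LinearMap.ker ((P * A : X →L[ℂ] X) : X →ₗ[ℂ] X) := by
      ext x
      rw [hN, hM, mem_formCompl_range hPs]
      rfl
    rw [this]
    exact hPAF.finite_ker
  have hkfin : FiniteDimensional ℂ (formKer (opForm A)) := by
    have : formKer (opForm A) = LinearMap.ker (A : X →ₗ[ℂ] X) := by
      ext x; exact mem_formKer_opForm
    rw [this]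
    exact hF.finite_ker
  refine ⟨hNfin, hkfin, hK.isCompactOperator, hBc.continuousOn, fun s _ => hBs s, fun s _ => hBF s,
    exists_isFlowSubdivision (exists_eventually_isAdmissibleLevel hBs hBc hBF hBB),
    fun n t e hsub => ?_⟩
  -- The sum telescopes, since the relative index does not involve the levels; hence its value is
  -- the same for all subdivisions.
  have hflow : flowSum B n t e = relIdx A₀ M - relIdx A M := by
    rw [flowSum, Finset.sum_congr rfl fun j hj => nonnegCount_sub_nonnegCount hP hker hM hBs hBc hPB
      hB0 (hsub.le_succ j (Finset.mem_range.1 hj)) (hsub.admissible j (Finset.mem_range.1 hj)),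
      Finset.sum_range_sub' (fun j => relIdx (B (t j)) M), hsub.start, hsub.finish, hB1, hBzero]
  have hzero : relIdx A₀ M = 0 := relIdx_compression hP hPA₀ hM (by
    have := (hBF 0).finite_ker
    rwa [hBzero] at this)
  rw [morseIndex_formRestrict, finrank_formKer_formRestrict, ENat.toNat_natCast, hN]
  change flowSum B n t e = _
  rw [hflow, hzero, zero_sub, relIdx]

end Main

end RelMorse

theorem proposition2p4 {X : Type*} [NormedAddCommGroup X] [InnerProductSpace ℂ X] [CompleteSpace X]
    (A P : X →L[ℂ] X) (hA : IsSelfAdjoint A) (hF : A.IsFredholm)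
    (hP : IsStarProjection P) (hker : FiniteDimensional ℂ (LinearMap.ker (P : X →ₗ[ℂ] X)))
    (M N : Submodule ℂ X) (hM : M = LinearMap.range (P : X →ₗ[ℂ] X))
    (hN : N = RelMorse.formCompl (RelMorse.opForm A) M) :
    FiniteDimensional ℂ N ∧ FiniteDimensional ℂ (RelMorse.formKer (RelMorse.opForm A)) ∧
      RelMorse.HasRelativeMorseIndex (P ∘L A ∘L P) A
        (((RelMorse.morseIndex (RelMorse.formRestrict (RelMorse.opForm A) N)).toNat : ℤ)
          + (Module.finrank ℂ (RelMorse.formKer (RelMorse.formRestrict (RelMorse.opForm A) N)) : ℤ)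
          - (Module.finrank ℂ (RelMorse.formKer (RelMorse.opForm A)) : ℤ)) :=
  RelMorse.hasRelativeMorseIndex_compression A P hA hF hP hker M N hM hN
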